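/- Let $p$ be a prime and $n$ a positive integer with $p\nmid n$, and let $G=\langle a\rangle\rtimes\langle b\rangle$ be a semidirect product of a normal cyclic subgroup $\langle a\rangle$ of order $p$ by a cyclic subgroup $\langle b\rangle$ of order $n$, where the kernel of the conjugation action of $\langle b\rangle$ on $\langle a\rangle$ has order $k$ (so $k\mid n$). Put $A=\langle a,b^{n/k}\rangle$. Let $\zeta_m$ denote a complex primitive $m$-th root of unity. For a subgroup $H$ of $G$ let $\widehat H=\frac1{|H|}\sum_{x\in H}x\in\mathbb QG$. For $K\trianglelefteq H\le G$ let $\varepsilon(H,H)=\widehat H$ and, if $K\ne H$, $\varepsilon(H,K)=\widehat K\prod_M(1-\widehat M)$, where $M$ runs over the minimal elements of the set of normal subgroups of $H$ properly containing $K$; let $e(G,H,K)$ be the sum of the distinct $G$-conjugates of $\varepsilon(H,K)$. For each $h\mid k$ put $B_h=\mathbb QG\,e(G,A,\langle b^{hn/k}\rangle)$. For a finite Galois extension $L/E$ with cyclic Galois group generated by $\sigma$ of order $d$, and $c\in E^{\times}$, let $(L/E,c)$ denote the cyclic algebra $\bigoplus_{i=0}^{d-1}L\,u^i$ with $u^d=c$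 and $ux=\sigma(x)u$ for $x\in L$. Then: 1. There is exactly one subfield $F$ of $\mathbb Q(\zeta_p)$ with $[F:\mathbb Q]=\frac{(p-1)k}{n}$. 2. If $G$ is non-commutative (equivalently $k\neq n$), then the non-commutative simple components of $\mathbb QG$ (its minimal nonzero two-sided ideals that are not commutative) are exactly the algebras $B_h$ with $h\mid k$. 3. For every $h\mid k$, $F(\zeta_h)\subseteq\mathbb Q(\zeta_{ph})$, the extension $\mathbb Q(\zeta_{ph})/F(\zeta_h)$ is finite Galois with cyclic Galois group, and $B_h\cong(\mathbb Q(\zeta_{ph})/F(\zeta_h),\zeta_h)$ as $\mathbb Q$-algebras, for every choice of the primitive roots of unity and of the generator $\sigma$ of the Galois group. -/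

import Mathlib

open scoped IntermediateField

noncomputable section

/-! ### Crossed products and cyclic algebras -/

/-- A factor set of `Gal(L/E)` with values in the units of `L`. -/
structure FactorSet (E L : Type*) [Field E] [Field L] [Algebra E L] where
  /-- The twisting. -/
  τ : (L ≃ₐ[E] L) → (L ≃ₐ[E] L) → Lˣ
  cocycle : ∀ g h k : L ≃ₐ[E] L,
    (τ g h : L) * τ (g * h) k = g (τ h k : L) * τ g (h * k)

/-- The underlying module `⨁ L u_g`, `g ∈ Gal(L/E)`, of the crossed product `(L/E, τ)`;
`Finsupp.single g x` is the element `x u_g`. -/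
def CrossedProduct {E L : Type*} [Field E] [Field L] [Algebra E L] (_c : FactorSet E L) : Type _ :=
  (L ≃ₐ[E] L) →₀ L

namespace CrossedProduct

variable {E L : Type*} [Field E] [Field L] [Algebra E L] (c : FactorSet E L)

instance : AddCommGroup (CrossedProduct c) :=
  inferInstanceAs (AddCommGroup ((L ≃ₐ[E] L) →₀ L))

instance {K : Type*} [CommSemiring K] [Algebra K L] : Module K (CrossedProduct c) :=
  inferInstanceAs (Module K ((L ≃ₐ[E] L) →₀ L))

/-- The element `x u_g`. -/
def mono (g : L ≃ₐ[E] L) (x : L) : CrossedProduct c := Finsupp.single g x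

/-- The multiplication, determined by `(x u_g) (y u_h) = x g(y) τ(g, h) u_{gh}`. -/
instance : Mul (CrossedProduct c) :=
  ⟨fun f f' => Finsupp.sum f fun g x => Finsupp.sum f' fun h y =>
    mono c (g * h) (x * g y * c.τ g h)⟩

/-- The identity element `τ(1,1)⁻¹ u_1`. -/
instance : One (CrossedProduct c) := ⟨mono c 1 ((c.τ 1 1)⁻¹ : Lˣ)⟩

theorem mono_zero (g : L ≃ₐ[E] L) : mono c g 0 = 0 := Finsupp.single_zero g

theorem mono_add (g : L ≃ₐ[E] L) (x y : L) : mono c g (x + y) = mono c g x + mono c g y :=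
  Finsupp.single_add g x y

theorem one_def : (1 : CrossedProduct c) = mono c 1 ((c.τ 1 1)⁻¹ : Lˣ) := rfl

theorem mul_def (f f' : CrossedProduct c) : f * f' =
    Finsupp.sum f fun g x => Finsupp.sum f' fun h y => mono c (g * h) (x * g y * c.τ g h) := rfl

theorem sum_mono {P : Type*} [AddCommMonoid P] (g : L ≃ₐ[E] L) (x : L)
    (F : (L ≃ₐ[E] L) → L → P) (hF : F g 0 = 0) : Finsupp.sum (mono c g x) F = F g x :=
  Finsupp.sum_single_index hF

theorem mono_mul_mono (g h : L ≃ₐ[E] L) (x y : L) :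
    mono c g x * mono c h y = mono c (g * h) (x * g y * c.τ g h) := by
  rw [mul_def, sum_mono, sum_mono]
  · simp [mono_zero]
  · rw [sum_mono] <;> simp [mono_zero]

variable {c} in
theorem induction {P : CrossedProduct c → Prop} (f : CrossedProduct c) (h0 : P 0)
    (hadd : ∀ f g, P f → P g → P (f + g)) (hmono : ∀ g x, P (mono c g x)) : P f :=
  Finsupp.induction_linear (motive := P) f h0 hadd hmono

protected theorem zero_mul (f : CrossedProduct c) : 0 * f = 0 := Finsupp.sum_zero_index

protected theorem mul_zero (f : CrossedProduct c) : f * 0 = 0 := by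
  rw [mul_def]
  exact Finset.sum_eq_zero fun _ _ => Finsupp.sum_zero_index

protected theorem add_mul (f f' g : CrossedProduct c) : (f + f') * g = f * g + f' * g := by
  simp only [mul_def]
  refine Finsupp.sum_add_index' (fun a => ?_) (fun a x y => ?_)
  · exact Finset.sum_eq_zero fun _ _ => by simp [mono_zero]
  · simp only [add_mul, mono_add]
    exact Finsupp.sum_add

protected theorem mul_add (f g g' : CrossedProduct c) : f * (g + g') = f * g + f * g' := by
  simp only [mul_def]
  refine Eq.trans (Finsupp.sum_congr fun a _ => ?_) Finsupp.sum_add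
  refine Finsupp.sum_add_index' (fun b => ?_) (fun b x y => ?_)
  · simp [mono_zero]
  · rw [map_add, mul_add, add_mul, mono_add]

protected theorem mul_assoc (f g h : CrossedProduct c) : f * g * h = f * (g * h) := by
  induction f using induction with
  | h0 => simp only [CrossedProduct.zero_mul]
  | hadd a b ha hb => simp only [CrossedProduct.add_mul, ha, hb]
  | hmono s x =>
  induction g using induction with
  | h0 => simp only [CrossedProduct.zero_mul, CrossedProduct.mul_zero]
  | hadd a b ha hb => simp only [CrossedProduct.add_mul, CrossedProduct.mul_add, ha, hb]
  | hmono t y =>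
  induction h using induction with
  | h0 => simp only [CrossedProduct.mul_zero]
  | hadd a b ha hb => simp only [CrossedProduct.mul_add, ha, hb]
  | hmono u z =>
  rw [mono_mul_mono, mono_mul_mono, mono_mul_mono, mono_mul_mono, mul_assoc s t u]
  congr 1
  rw [map_mul, map_mul, AlgEquiv.mul_apply]
  linear_combination x * s y * s (t z) * c.cocycle s t u

protected theorem one_mul (f : CrossedProduct c) : 1 * f = f := by
  induction f using induction with
  | h0 => simp only [CrossedProduct.mul_zero]
  | hadd a b ha hb => simp only [CrossedProduct.mul_add, ha, hb]
  | hmono t y =>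
  have h : (c.τ 1 1 : L) = c.τ 1 t := by
    have := c.cocycle 1 1 t
    simp only [one_mul, AlgEquiv.one_apply] at this
    exact mul_right_cancel₀ (Units.ne_zero _) this
  rw [one_def, mono_mul_mono, ← h, one_mul, AlgEquiv.one_apply, mul_right_comm, Units.inv_mul,
    one_mul]

protected theorem mul_one (f : CrossedProduct c) : f * 1 = f := by
  induction f using induction with
  | h0 => simp only [CrossedProduct.zero_mul]
  | hadd a b ha hb => simp only [CrossedProduct.add_mul, ha, hb]
  | hmono t y =>
  have h : (c.τ t 1 : L) = t (c.τ 1 1 : L) := by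
    have := c.cocycle t 1 1
    simp only [mul_one] at this
    exact mul_right_cancel₀ (Units.ne_zero _) this
  rw [one_def, mono_mul_mono, h, mul_assoc, ← map_mul, Units.inv_mul, map_one, mul_one, mul_one]

instance : Ring (CrossedProduct c) :=
  { (inferInstance : AddCommGroup (CrossedProduct c)) with
    mul := (· * ·)
    one := 1
    left_distrib := CrossedProduct.mul_add c
    right_distrib := CrossedProduct.add_mul c
    zero_mul := CrossedProduct.zero_mul c
    mul_zero := CrossedProduct.mul_zero c
    mul_assoc := CrossedProduct.mul_assoc c
    one_mul := CrossedProduct.one_mul c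
    mul_one := CrossedProduct.mul_one c }

theorem smul_mono {K : Type*} [CommSemiring K] [Algebra K L] (r : K) (g : L ≃ₐ[E] L) (x : L) :
    r • mono c g x = mono c g (r • x) := Finsupp.smul_single r g x

/-- The algebra structure over `E`, and over every `K` that maps to `E`. -/
instance {K : Type*} [CommSemiring K] [Algebra K E] [Algebra K L] [IsScalarTower K E L] :
    Algebra K (CrossedProduct c) :=
  Algebra.ofModule
    (fun r f g => by
      induction f using induction with
      | h0 => simp only [smul_zero, zero_mul]
      | hadd a b ha hb => simp only [smul_add, add_mul, ha, hb]
      | hmono s x =>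
      induction g using induction with
      | h0 => simp only [smul_zero, mul_zero]
      | hadd a b ha hb => simp only [smul_add, mul_add, ha, hb]
      | hmono t y =>
      simp only [mono_mul_mono, smul_mono, smul_mul_assoc])
    (fun r f g => by
      induction f using induction with
      | h0 => simp only [smul_zero, zero_mul]
      | hadd a b ha hb => simp only [smul_add, add_mul, ha, hb]
      | hmono s x =>
      induction g using induction with
      | h0 => simp only [smul_zero, mul_zero]
      | hadd a b ha hb => simp only [smul_add, mul_add, ha, hb]
      | hmono t y =>
      have : s (r • y) = r • s y := by
        rw [← IsScalarTower.algebraMap_smul E r y, map_smul, IsScalarTower.algebraMap_smul]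
      simp only [mono_mul_mono, smul_mono, this, mul_smul_comm, smul_mul_assoc])

end CrossedProduct

/-- The least natural number `i` with `σ ^ i = g`. -/
def powIndex {Γ : Type*} [Group Γ] (σ g : Γ) : ℕ := sInf {i : ℕ | σ ^ i = g}

theorem pow_powIndex {Γ : Type*} [Group Γ] [Finite Γ] {σ : Γ}
    (hσ : ∀ g, g ∈ Subgroup.zpowers σ) (g : Γ) : σ ^ powIndex σ g = g := by
  have : {i : ℕ | σ ^ i = g}.Nonempty := mem_powers_iff_mem_zpowers.2 (hσ g)
  exact Nat.sInf_mem this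

theorem powIndex_lt {Γ : Type*} [Group Γ] [Finite Γ] {σ : Γ}
    (hσ : ∀ g, g ∈ Subgroup.zpowers σ) (g : Γ) : powIndex σ g < orderOf σ := by
  have h : powIndex σ g % orderOf σ ∈ {i : ℕ | σ ^ i = g} := by
    rw [Set.mem_ofPred_eq, pow_mod_orderOf, pow_powIndex hσ]
  exact lt_of_le_of_lt (Nat.sInf_le h) (Nat.mod_lt _ (orderOf_pos σ))

theorem powIndex_mul {Γ : Type*} [Group Γ] [Finite Γ] {σ : Γ}
    (hσ : ∀ g, g ∈ Subgroup.zpowers σ) (g h : Γ) :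
    powIndex σ (g * h) = if powIndex σ g + powIndex σ h < orderOf σ
      then powIndex σ g + powIndex σ h else powIndex σ g + powIndex σ h - orderOf σ := by
  have hg := powIndex_lt hσ g
  have hh := powIndex_lt hσ h
  refine pow_injOn_Iio_orderOf (x := σ) (powIndex_lt hσ (g * h)) ?_ ?_
  · rw [Set.mem_Iio]
    split_ifs <;> omega
  · dsimp only
    rw [pow_powIndex hσ]
    split_ifs with hlt
    · rw [pow_add, pow_powIndex hσ, pow_powIndex hσ]
    · have : σ ^ (powIndex σ g + powIndex σ h - orderOf σ) * σ ^ orderOf σ = g * h := by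
        rw [← pow_add, Nat.sub_add_cancel (not_lt.1 hlt), pow_add, pow_powIndex hσ,
          pow_powIndex hσ]
      rw [← this, pow_orderOf_eq_one, mul_one]

/-- If `σ` is a generator of `Gal(L/E)`, of order `n`, and `a` is a unit of `E`: the factor set
with `τ(σ^i, σ^j) = 1` if `i + j < n` and `τ(σ^i, σ^j) = a` if `i + j ≥ n` (`0 ≤ i, j < n`), so
that, for `n ≥ 2`, `u_{σ^i} = u_σ^i` for `0 ≤ i < n` and `u_σ^n = a`.
For `n = 1` the factor set is trivial and the crossed product is `L = E`. -/
def FactorSet.cyclic {E L : Type*} [Field E] [Field L] [Algebra E L] [FiniteDimensional E L]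
    (σ : L ≃ₐ[E] L) (hσ : ∀ g, g ∈ Subgroup.zpowers σ) (a : Eˣ) : FactorSet E L where
  τ g h := if powIndex σ g + powIndex σ h < orderOf σ then 1
    else Units.map (algebraMap E L : E →* L) a
  cocycle g h k := by
    have hg := powIndex_lt hσ g
    have hh := powIndex_lt hσ h
    have hk := powIndex_lt hσ k
    rw [powIndex_mul hσ g h, powIndex_mul hσ h k]
    split_ifs <;> first | omega | simp

/-- The cyclic algebra `(L/E, a)`, with respect to the generator `σ` of `Gal(L/E)`. -/
abbrev CyclicAlgebra {E L : Type*} [Field E] [Field L] [Algebra E L] [FiniteDimensional E L]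
    (σ : L ≃ₐ[E] L) (hσ : ∀ g, g ∈ Subgroup.zpowers σ) (a : Eˣ) : Type _ :=
  CrossedProduct (FactorSet.cyclic σ hσ a)

/-! ### Idempotents of the rational group algebra -/

/-- `Ĥ = |H|⁻¹ ∑_{h ∈ H} h`. -/
def hatElt {G : Type*} [Group G] (H : Subgroup G) : MonoidAlgebra ℚ G :=
  (Nat.card H : ℚ)⁻¹ • ∑ᶠ h : H, MonoidAlgebra.of ℚ G (h : G)

/-- `M` is minimal among the normal subgroups of `H` that contain `K` properly. -/
def IsMinimalNormalOver {G : Type*} [Group G] (H K M : Subgroup G) : Prop :=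
  Minimal (fun N : Subgroup G => N ≤ H ∧ (N.subgroupOf H).Normal ∧ K < N) M

theorem commute_hatElt {G : Type*} [Group G] [Finite G] {H M N : Subgroup G} (hN : N ≤ H)
    (hNn : (N.subgroupOf H).Normal) (hM : M ≤ H) : Commute (hatElt M) (hatElt N) := by
  have := Fintype.ofFinite N
  have := Fintype.ofFinite M
  have key : ∀ m ∈ H, Commute (MonoidAlgebra.of ℚ G m) (hatElt N) := by
    intro m hm
    refine Commute.smul_right ?_ _
    rw [finsum_eq_sum_of_fintype, commute_iff_eq, Finset.mul_sum, Finset.sum_mul]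
    have hc : ∀ x ∈ H, ∀ y ∈ N, x * y * x⁻¹ ∈ N := fun x hx y hy =>
      hNn.conj_mem ⟨y, hN hy⟩ hy ⟨x, hx⟩
    let e : N ≃ N :=
      { toFun := fun y => ⟨m * y * m⁻¹, hc m hm y y.2⟩
        invFun := fun y => ⟨m⁻¹ * y * m, by simpa using hc m⁻¹ (H.inv_mem hm) y y.2⟩
        left_inv := fun y => by ext; simp [mul_assoc]
        right_inv := fun y => by ext; simp [mul_assoc] }
    refine Fintype.sum_equiv e _ _ fun y => ?_
    rw [← map_mul, ← map_mul]
    simp [e]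
  refine Commute.smul_left ?_ _
  rw [finsum_eq_sum_of_fintype]
  exact Commute.sum_left _ _ _ fun m _ => key m (hM m.2)

open Classical in
/-- `ε(H, K)`: it is `Ĥ` if `K = H`, and `K̂ ∏ (1 - M̂)` otherwise, the product over all minimal
normal subgroups `M` of `H` containing `K` properly (its factors commute). -/
def epsElt {G : Type*} [Group G] [Finite G] (H K : Subgroup G) : MonoidAlgebra ℚ G :=
  if K = H then hatElt H else
    hatElt K * (Set.toFinite {M : Subgroup G | IsMinimalNormalOver H K M}).toFinset.noncommProd
      (fun M => 1 - hatElt M) (by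
        intro M hM N hN _
        rw [Finset.mem_coe, Set.Finite.mem_toFinset] at hM hN
        exact (Commute.one_left _).sub_left
          ((Commute.one_right _).sub_right (commute_hatElt hN.1.1 hN.1.2.1 hM.1.1)))

/-- `e(G, H, K)`: the sum of the distinct `G`-conjugates of `ε(H, K)`. -/
def eElt {G : Type*} [Group G] [Finite G] (H K : Subgroup G) : MonoidAlgebra ℚ G :=
  ∑ᶠ x ∈ Set.range (fun g : G =>
    MonoidAlgebra.of ℚ G g⁻¹ * epsElt H K * MonoidAlgebra.of ℚ G g), x

/-! ### Simple components -/

/-- The set `R e = {x e : x ∈ R}` with the operations of `R`. -/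
def componentOf {R : Type*} [Ring R] [Algebra ℚ R] (e : R) : NonUnitalSubalgebra ℚ R where
  carrier := Set.range fun x => x * e
  add_mem' := by
    rintro _ _ ⟨x, rfl⟩ ⟨y, rfl⟩
    exact ⟨x + y, add_mul x y e⟩
  zero_mem' := ⟨0, zero_mul e⟩
  mul_mem' := by
    rintro _ _ ⟨x, rfl⟩ ⟨y, rfl⟩
    exact ⟨x * e * y, by simp only [mul_assoc]⟩
  smul_mem' := by
    rintro r _ ⟨x, rfl⟩
    exact ⟨r • x, smul_mul_assoc r x e⟩

/-- `B` is a simple component of the semisimple algebra `R`: a minimal nonzero two-sided ideal. -/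
def IsSimpleComponent {R : Type*} [Ring R] [Algebra ℚ R] (B : NonUnitalSubalgebra ℚ R) : Prop :=
  ∃ I : TwoSidedIdeal R, IsAtom I ∧ (B : Set R) = {x | x ∈ I}

/-- The algebra `B_h = ℚG e(G, A, ⟨b^{hn/k}⟩)`, where `A = ⟨a, b^{n/k}⟩`. -/
def compB {G : Type*} [Group G] [Finite G] (a b : G) (n k h : ℕ) :
    NonUnitalSubalgebra ℚ (MonoidAlgebra ℚ G) :=
  componentOf (eElt (Subgroup.closure {a, b ^ (n / k)}) (Subgroup.zpowers (b ^ (h * (n / k)))))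

end

/-! Put d = n/k. Conjugation by b raises a to a power r, viewed in (ℤ/p)ˣ; its order is d, so d
divides p - 1 and (p-1)k/n = (p-1)/d. The group A is cyclic, generated by g₀ = a b^d, and normal in
G, so every subgroup of A is normal in G. Hence each ε_h = ε(A, ⟨b^{hd}⟩) is central and has no
other conjugates: e(G, A, ⟨b^{hd}⟩) = ε_h.

Let E = F(ζ_h) and L = ℚ(ζ_{ph}). Then [L : E] = d (`relfinrank_sup_adjoin`), and Gal(L/E) embeds in
(ℤ/p)ˣ through its action on ζ_p, so it is cyclic. If a generator σ acts on ζ_p with exponent r,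
then a ↦ ζ_p, b ↦ u defines a surjection ψ from ℚG to (L/E, ζ_h), under which g₀ becomes the
primitive ph-th root of unity ζ_p ζ_h. Consequently ψ(ε_h) = 1. Moreover ker ψ annihilates ε_h: an
element of ℚG is ∑ f_i(g₀) b^i with i < d, it lies in ker ψ only if the cyclotomic polynomial Φ_{ph}
divides every f_i, and Φ_{ph}(g₀) ε_h = 0 (`aeval_cyclotomic_mul_epsElt`). Thus B_h ≅ (L/E, ζ_h).
For any other generator σ, b is replaced by a power b^j with j prime to n, which changes neither A
nor ⟨b^{hd}⟩.

Crossed products are simple (`one_mem_of_ne_zero`), so each B_h is a minimal ideal, non-commutative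
when d ≠ 1. Conversely, a minimal ideal different from all B_h is annihilated by all ε_h. It then
lies in ℚG Ĥ with H = ⟨a⟩ (`eq_mul_hatElt`), which is commutative because G/⟨a⟩ is cyclic. -/

/-! ### Coefficients and simplicity of crossed products -/

namespace CrossedProduct

variable {E L : Type*} [Field E] [Field L] [Algebra E L] (c : FactorSet E L)

/-- The coefficient of `u_g`. -/
noncomputable def coeff {c : FactorSet E L} (f : CrossedProduct c) (g : L ≃ₐ[E] L) : L :=
  DFunLike.coe (F := (L ≃ₐ[E] L) →₀ L) f g

/-- The set of all `g` such that the coefficient of `u_g` is nonzero. -/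
noncomputable def supp {c : FactorSet E L} (f : CrossedProduct c) : Finset (L ≃ₐ[E] L) :=
  Finsupp.support (M := L) f

variable {c}

theorem mem_supp {f : CrossedProduct c} {g : L ≃ₐ[E] L} : g ∈ supp f ↔ coeff f g ≠ 0 :=
  Finsupp.mem_support_iff

theorem ext_coeff {f f' : CrossedProduct c} (h : ∀ g, coeff f g = coeff f' g) : f = f' :=
  Finsupp.ext (M := L) h

theorem coeff_zero (g : L ≃ₐ[E] L) : coeff (0 : CrossedProduct c) g = 0 := rfl

theorem coeff_add (f f' : CrossedProduct c) (g : L ≃ₐ[E] L) :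
    coeff (f + f') g = coeff f g + coeff f' g := rfl

theorem coeff_sub (f f' : CrossedProduct c) (g : L ≃ₐ[E] L) :
    coeff (f - f') g = coeff f g - coeff f' g := rfl

theorem coeff_mono_self (g : L ≃ₐ[E] L) (x : L) : coeff (mono c g x) g = x :=
  Finsupp.single_eq_same

theorem coeff_mono_of_ne {g h : L ≃ₐ[E] L} (hgh : h ≠ g) (x : L) : coeff (mono c g x) h = 0 :=
  Finsupp.single_eq_of_ne hgh

theorem coeff_mono_mul (s h : L ≃ₐ[E] L) (x : L) (f : CrossedProduct c) :
    coeff (mono c s x * f) (s * h) = x * s (coeff f h) * c.τ s h := by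
  induction f using induction with
  | h0 => simp [coeff_zero]
  | hadd f f' hf hf' => rw [mul_add, coeff_add, hf, hf', coeff_add, map_add]; ring
  | hmono t y =>
    rw [mono_mul_mono]
    by_cases h1 : h = t
    · rw [h1, coeff_mono_self, coeff_mono_self]
    · rw [coeff_mono_of_ne h1, coeff_mono_of_ne fun h2 => h1 (mul_left_cancel h2)]
      simp

theorem coeff_mul_mono (g t : L ≃ₐ[E] L) (y : L) (f : CrossedProduct c) :
    coeff (f * mono c t y) (g * t) = coeff f g * g y * c.τ g t := by
  induction f using induction with
  | h0 => simp [coeff_zero]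
  | hadd f f' hf hf' => rw [add_mul, coeff_add, hf, hf', coeff_add]; ring
  | hmono s x =>
    rw [mono_mul_mono]
    by_cases h1 : g = s
    · rw [h1, coeff_mono_self, coeff_mono_self]
    · rw [coeff_mono_of_ne h1, coeff_mono_of_ne fun h2 => h1 (mul_right_cancel h2)]
      simp

theorem τ_one_left (c : FactorSet E L) (t : L ≃ₐ[E] L) : (c.τ 1 t : L) = c.τ 1 1 := by
  have := c.cocycle 1 1 t
  simp only [one_mul, AlgEquiv.one_apply] at this
  exact (mul_right_cancel₀ (Units.ne_zero _) this).symm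

theorem τ_one_right (c : FactorSet E L) (t : L ≃ₐ[E] L) : (c.τ t 1 : L) = t (c.τ 1 1 : L) := by
  have := c.cocycle t 1 1
  simp only [mul_one] at this
  exact mul_right_cancel₀ (Units.ne_zero _) this

variable (c) in
/-- The embedding of the field `L`. -/
noncomputable def ofField : L →+* CrossedProduct c where
  toFun x := mono c 1 (x * ((c.τ 1 1)⁻¹ : Lˣ))
  map_one' := by rw [one_mul]; rfl
  map_mul' x y := by
    rw [mono_mul_mono, mul_one]
    congr 1
    rw [AlgEquiv.one_apply]
    have := Units.inv_mul (c.τ 1 1)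
    linear_combination (-x * y * ((c.τ 1 1)⁻¹ : Lˣ)) * this
  map_zero' := by rw [zero_mul, mono_zero]
  map_add' x y := by rw [add_mul, mono_add]

theorem coeff_ofField_mul (x : L) (f : CrossedProduct c) (g : L ≃ₐ[E] L) :
    coeff (ofField c x * f) g = x * coeff f g := by
  have := coeff_mono_mul 1 g (x * ((c.τ 1 1)⁻¹ : Lˣ)) f
  rw [one_mul, AlgEquiv.one_apply, τ_one_left] at this
  refine this.trans ?_
  have := Units.inv_mul (c.τ 1 1)
  linear_combination (x * coeff f g) * this

theorem coeff_mul_ofField (x : L) (f : CrossedProduct c) (g : L ≃ₐ[E] L) :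
    coeff (f * ofField c x) g = coeff f g * g x := by
  have := coeff_mul_mono g 1 (x * ((c.τ 1 1)⁻¹ : Lˣ)) f
  rw [mul_one, τ_one_right] at this
  refine this.trans ?_
  rw [mul_assoc, ← map_mul, mul_assoc, Units.inv_mul, mul_one]

theorem ofField_mul_mono (x y : L) (g : L ≃ₐ[E] L) :
    ofField c x * mono c g y = mono c g (x * y) := by
  refine ext_coeff fun h => ?_
  rw [coeff_ofField_mul]
  by_cases hg : h = g
  · rw [hg, coeff_mono_self, coeff_mono_self]
  · rw [coeff_mono_of_ne hg, coeff_mono_of_ne hg, mul_zero]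

theorem mono_mul_ofField (x y : L) (g : L ≃ₐ[E] L) :
    mono c g y * ofField c x = mono c g (y * g x) := by
  refine ext_coeff fun h => ?_
  rw [coeff_mul_ofField]
  by_cases hg : h = g
  · rw [hg, coeff_mono_self, coeff_mono_self]
  · rw [coeff_mono_of_ne hg, coeff_mono_of_ne hg, zero_mul]

/-- Every nonzero two-sided ideal of a crossed product is the whole ring. -/
theorem one_mem_of_ne_zero (I : TwoSidedIdeal (CrossedProduct c)) {f : CrossedProduct c}
    (hf : f ∈ I) (hf0 : f ≠ 0) : 1 ∈ I := by
  classical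
  -- Choose a nonzero element of the ideal with the fewest nonzero coefficients.
  obtain ⟨f, ⟨hf, hf0⟩, hmin⟩ := exists_minimalFor_of_wellFoundedLT
    (fun f : CrossedProduct c => f ∈ I ∧ f ≠ 0) (fun f => (supp f).card) ⟨f, hf, hf0⟩
  have hlt : ∀ f' ∈ I, (supp f').card < (supp f).card → f' = 0 := by
    intro f' h1 h2
    by_contra h3
    exact absurd (hmin ⟨h1, h3⟩ h2.le) (not_le.2 h2)
  obtain ⟨s, hs⟩ : ∃ s, coeff f s ≠ 0 := by
    by_contra! h
    exact hf0 (ext_coeff h)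
  -- Translating the support by `s⁻¹` puts 1 into it without making it larger.
  obtain ⟨f', hf'⟩ : ∃ f', f' = f * mono c s⁻¹ 1 := ⟨_, rfl⟩
  have hf'I : f' ∈ I := hf' ▸ I.mul_mem_right _ _ hf
  have hc : ∀ g, coeff f' g = coeff f (g * s) * c.τ (g * s) s⁻¹ := by
    intro g
    have := coeff_mul_mono (g * s) s⁻¹ 1 f
    rwa [mul_inv_cancel_right, map_one, mul_one, ← hf'] at this
  have hcard : (supp f').card ≤ (supp f).card := by
    refine Finset.card_le_card_of_injOn (fun g => g * s) (fun g hg => ?_)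
      (fun _ _ _ _ h => mul_right_cancel h)
    have := mem_supp.1 (Finset.mem_coe.1 hg)
    rw [hc] at this
    exact mem_supp.2 (left_ne_zero_of_mul this)
  have h1 : coeff f' 1 ≠ 0 := by
    rw [hc, one_mul]
    exact mul_ne_zero hs (Units.ne_zero _)
  have hfix : ∀ g, coeff f' g ≠ 0 → g = 1 := by
    intro g hg
    ext x
    -- The commutator with `x` has coefficient `f'_g (x - g x)` at `g`; it loses the term at 1, so
    -- minimality makes it vanish, and every `g` in the support fixes every `x`.
    have hx : ofField c x * f' - f' * ofField c x = 0 := by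
      refine hlt _ (I.sub_mem (I.mul_mem_left _ _ hf'I) (I.mul_mem_right _ _ hf'I))
        (lt_of_lt_of_le (Finset.card_lt_card ?_) hcard)
      refine (Finset.ssubset_iff_of_subset fun g hg => ?_).2 ⟨1, mem_supp.2 h1, fun h => ?_⟩
      · rw [mem_supp, coeff_sub, coeff_ofField_mul, coeff_mul_ofField] at hg
        refine mem_supp.2 fun h0 => hg ?_
        rw [h0, mul_zero, zero_mul, sub_zero]
      · refine mem_supp.1 h ?_
        rw [coeff_sub, coeff_ofField_mul, coeff_mul_ofField, AlgEquiv.one_apply]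
        ring
    have := congrArg (coeff · g) hx
    simp only [coeff_sub, coeff_ofField_mul, coeff_mul_ofField, coeff_zero] at this
    have h2 : coeff f' g * (x - g x) = 0 := by linear_combination this
    rw [AlgEquiv.one_apply]
    exact (sub_eq_zero.1 ((mul_eq_zero.1 h2).resolve_left hg)).symm
  -- Only the coefficient at 1 is left, so `f'` is a nonzero element of `L` up to the normalization
  -- of the identity.
  have hfin : ofField c ((coeff f' 1)⁻¹ * ((c.τ 1 1)⁻¹ : Lˣ)) * f' = 1 := by
    refine ext_coeff fun g => ?_
    rw [coeff_ofField_mul, one_def]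
    by_cases hg : g = 1
    · subst hg
      rw [coeff_mono_self]
      field_simp
    · rw [coeff_mono_of_ne hg]
      by_contra h
      exact hg (hfix g (right_ne_zero_of_mul h))
  exact hfin ▸ I.mul_mem_left _ _ hf'I

end CrossedProduct

/-! ### Cyclic algebras as polynomials in u over L -/

namespace CyclicAlgebra

open CrossedProduct

variable {E L : Type*} [Field E] [Field L] [Algebra E L] [FiniteDimensional E L]
    (σ : L ≃ₐ[E] L) (hσ : ∀ g, g ∈ Subgroup.zpowers σ) (a : Eˣ)

theorem powIndex_pow {Γ : Type*} [Group Γ] [Finite Γ] {σ : Γ}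
    (hσ : ∀ g, g ∈ Subgroup.zpowers σ) {i : ℕ} (hi : i < orderOf σ) : powIndex σ (σ ^ i) = i :=
  pow_injOn_Iio_orderOf (powIndex_lt hσ _) hi (pow_powIndex hσ _)

theorem τ_pow_pow {i j : ℕ} (hi : i < orderOf σ) (hj : j < orderOf σ) :
    (FactorSet.cyclic σ hσ a).τ (σ ^ i) (σ ^ j) = if i + j < orderOf σ then 1
      else Units.map (algebraMap E L : E →* L) a := by
  simp only [FactorSet.cyclic, powIndex_pow hσ hi, powIndex_pow hσ hj]

theorem τ_one_one : (FactorSet.cyclic σ hσ a).τ 1 1 = 1 := by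
  have h := orderOf_pos σ
  simpa [h] using τ_pow_pow σ hσ a h h

theorem ofField_apply (x : L) :
    ofField (FactorSet.cyclic σ hσ a) x = mono (FactorSet.cyclic σ hσ a) 1 x := by
  change mono _ 1 (x * _) = _
  rw [τ_one_one, inv_one, Units.val_one, mul_one]

open Classical in
/-- An element `u` with `u x = σ(x) u` for `x` in `L` and `u ^ n = a`, where `n` is the order
of `σ`. -/
noncomputable def gen : CyclicAlgebra σ hσ a :=
  -- For trivial `σ` the element `u_σ` is the identity, so `a` itself is needed to have `u ^ 1 = a`.
  if orderOf σ = 1 then mono _ 1 (algebraMap E L a) else mono _ σ 1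

theorem gen_mul_ofField (x : L) :
    gen σ hσ a * ofField _ x = ofField _ (σ x) * gen σ hσ a := by
  rw [gen]
  split_ifs with h
  · have hx : σ x = x := by rw [orderOf_eq_one_iff.1 h, AlgEquiv.one_apply]
    rw [mono_mul_ofField, ofField_mul_mono, hx, AlgEquiv.one_apply, mul_comm]
  · rw [mono_mul_ofField, ofField_mul_mono, mul_comm]

theorem gen_pow {i : ℕ} (hi : i < orderOf σ) : gen σ hσ a ^ i = mono _ (σ ^ i) 1 := by
  induction i with
  | zero => rw [pow_zero, pow_zero, one_def, τ_one_one, inv_one, Units.val_one]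
  | succ i ih =>
    have h1 : 1 < orderOf σ := by omega
    have hτ := τ_pow_pow σ hσ a (i.lt_succ_self.trans hi) h1
    rw [pow_one, if_pos hi] at hτ
    rw [pow_succ, ih (i.lt_succ_self.trans hi), gen, if_neg h1.ne', mono_mul_mono, hτ, pow_succ]
    simp

theorem gen_pow_orderOf :
    gen σ hσ a ^ orderOf σ = ofField _ (algebraMap E L a) := by
  rw [ofField_apply]
  obtain ⟨d, hd⟩ : ∃ d, orderOf σ = d + 1 := Nat.exists_eq_succ_of_ne_zero (orderOf_pos σ).ne'
  obtain rfl | hd0 := Nat.eq_zero_or_pos d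
  · rw [hd, zero_add, pow_one, gen, if_pos hd]
  · have h1 : 1 < orderOf σ := by omega
    have hτ := τ_pow_pow σ hσ a (show d < orderOf σ by omega) h1
    rw [pow_one, if_neg (by omega)] at hτ
    rw [hd, pow_succ, gen_pow σ hσ a (by omega), gen, if_neg h1.ne', mono_mul_mono, hτ, ← pow_succ,
      ← hd, pow_orderOf_eq_one]
    simp

theorem ofField_mul_gen_pow (x : L) {i : ℕ} (hi : i < orderOf σ) :
    ofField _ x * gen σ hσ a ^ i = mono _ (σ ^ i) x := by
  rw [gen_pow σ hσ a hi, ofField_mul_mono, mul_one]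

theorem exists_eq_sum (f : CyclicAlgebra σ hσ a) :
    ∃ x : ℕ → L, f = ∑ i ∈ Finset.range (orderOf σ), ofField _ (x i) * gen σ hσ a ^ i := by
  induction f using CrossedProduct.induction with
  | h0 => exact ⟨0, by simp⟩
  | hadd f g hf hg =>
    obtain ⟨x, rfl⟩ := hf
    obtain ⟨y, rfl⟩ := hg
    exact ⟨x + y, by simp [add_mul, Finset.sum_add_distrib]⟩
  | hmono g x =>
    refine ⟨Pi.single (powIndex σ g) x, ?_⟩
    have hg := powIndex_lt hσ g
    rw [Finset.sum_eq_single (powIndex σ g)]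
    · rw [Pi.single_eq_same, ofField_mul_gen_pow σ hσ a _ hg, pow_powIndex hσ]
    · intro i _ hi
      rw [Pi.single_eq_of_ne hi, map_zero, zero_mul]
    · exact fun h => absurd (Finset.mem_range.2 hg) h

/-- The powers `σ ^ i` with `i < orderOf σ` are distinct, so the expansion in powers of `u` is
unique. The kernel of the representation of `G` is computed from this. -/
theorem coeff_sum (x : ℕ → L) {j : ℕ} (hj : j < orderOf σ) :
    coeff (∑ i ∈ Finset.range (orderOf σ), ofField _ (x i) * gen σ hσ a ^ i) (σ ^ j) = x j := by
  let F : CyclicAlgebra σ hσ a →+ L :=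
    { toFun := fun f => coeff f (σ ^ j), map_zero' := rfl, map_add' := fun _ _ => rfl }
  change F _ = _
  rw [map_sum, Finset.sum_eq_single j]
  · rw [ofField_mul_gen_pow σ hσ a _ hj]
    exact coeff_mono_self (c := FactorSet.cyclic σ hσ a) _ _
  · intro i hi hij
    rw [ofField_mul_gen_pow σ hσ a _ (Finset.mem_range.1 hi)]
    exact coeff_mono_of_ne (c := FactorSet.cyclic σ hσ a)
      (fun h => hij (pow_injOn_Iio_orderOf (Finset.mem_range.1 hi) hj h.symm)) _
  · exact fun h => absurd (Finset.mem_range.2 hj) h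

end CyclicAlgebra

/-! ### The idempotents Ĥ -/

section HatElt

variable {G : Type*} [Group G]

open MonoidAlgebra

theorem of_mul_hatElt [Finite G] {H : Subgroup G} {m : G} (hm : m ∈ H) :
    of ℚ G m * hatElt H = hatElt H := by
  have := Fintype.ofFinite H
  rw [hatElt, finsum_eq_sum_of_fintype, mul_smul_comm, Finset.mul_sum]
  congr 1
  refine Fintype.sum_equiv (Equiv.mulLeft ⟨m, hm⟩) _ _ fun h => ?_
  rw [← map_mul]
  rfl

theorem hatElt_mul_of_forall [Finite G] {H : Subgroup G} {x : MonoidAlgebra ℚ G}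
    (hx : ∀ m ∈ H, of ℚ G m * x = x) : hatElt H * x = x := by
  have := Fintype.ofFinite H
  rw [hatElt, finsum_eq_sum_of_fintype, smul_mul_assoc, Finset.sum_mul,
    Finset.sum_congr rfl fun (h : H) _ => hx h h.2, Finset.sum_const, Finset.card_univ,
    ← Nat.card_eq_fintype_card, ← Nat.cast_smul_eq_nsmul ℚ, smul_smul, inv_mul_cancel₀, one_smul]
  exact Nat.cast_ne_zero.2 Nat.card_pos.ne'

theorem hatElt_mul_hatElt_of_le [Finite G] {K H : Subgroup G} (h : K ≤ H) :
    hatElt K * hatElt H = hatElt H :=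
  hatElt_mul_of_forall fun _ hm => of_mul_hatElt (h hm)

theorem commute_of_forall_commute_of {e : MonoidAlgebra ℚ G}
    (h : ∀ g : G, Commute (of ℚ G g) e) (x : MonoidAlgebra ℚ G) : Commute x e := by
  induction x using MonoidAlgebra.induction_on with
  | of g => exact h g
  | add x y hx hy => exact hx.add_left hy
  | smul r x hx => exact hx.smul_left r

theorem commute_hatElt_of_normal [Finite G] {N : Subgroup G} (hN : N.Normal)
    (x : MonoidAlgebra ℚ G) : Commute x (hatElt N) := by
  have := Fintype.ofFinite N
  refine commute_of_forall_commute_of (fun g => ?_) x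
  refine Commute.smul_right ?_ _
  rw [finsum_eq_sum_of_fintype, commute_iff_eq, Finset.mul_sum, Finset.sum_mul]
  let e : N ≃ N :=
    { toFun := fun y => ⟨g * y * g⁻¹, hN.conj_mem y y.2 g⟩
      invFun := fun y => ⟨g⁻¹ * y * g, by simpa using hN.conj_mem y y.2 g⁻¹⟩
      left_inv := fun y => by ext; simp [mul_assoc]
      right_inv := fun y => by ext; simp [mul_assoc] }
  refine Fintype.sum_equiv e _ _ fun y => ?_
  rw [← map_mul, ← map_mul]
  simp [e]

theorem map_hatElt_eq_one [Finite G] {V : Type*} [Ring V] [Algebra ℚ V]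
    (ψ : MonoidAlgebra ℚ G →ₐ[ℚ] V)
    {H : Subgroup G} (h : ∀ m ∈ H, ψ (of ℚ G m) = 1) : ψ (hatElt H) = 1 := by
  have := Fintype.ofFinite H
  rw [hatElt, finsum_eq_sum_of_fintype, map_smul, map_sum,
    Finset.sum_congr rfl fun (m : H) _ => h m m.2, Finset.sum_const, Finset.card_univ,
    ← Nat.card_eq_fintype_card, ← Nat.cast_smul_eq_nsmul ℚ, smul_smul, inv_mul_cancel₀, one_smul]
  exact Nat.cast_ne_zero.2 Nat.card_pos.ne'

/-- Since `m Ĥ = Ĥ`, the unit `ψ(m) - 1` annihilates `ψ(Ĥ)`. -/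
theorem map_hatElt_eq_zero [Finite G] {V : Type*} [Ring V] [Algebra ℚ V]
    (ψ : MonoidAlgebra ℚ G →ₐ[ℚ] V)
    {H : Subgroup G} {m : G} (hm : m ∈ H) (h : IsUnit (ψ (of ℚ G m) - 1)) :
    ψ (hatElt H) = 0 := by
  refine h.mul_right_eq_zero.1 ?_
  rw [sub_mul, one_mul, ← map_mul, of_mul_hatElt hm, sub_self]

end HatElt

/-! ### The elements ε(H, K) -/

section EpsElt

variable {G : Type*} [Group G] [Finite G]

open MonoidAlgebra

/-- Hides the choice of the finite set and of the commutation proof in the non-commutative product.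
-/
theorem epsElt_of_ne {H K : Subgroup G} (h : K ≠ H) :
    ∃ S : Finset (Subgroup G), (∀ M, M ∈ S ↔ IsMinimalNormalOver H K M) ∧ ∃ comm,
    epsElt H K = hatElt K * S.noncommProd (fun M => 1 - hatElt M) comm :=
  ⟨_, fun _ => (Set.toFinite {M : Subgroup G | IsMinimalNormalOver H K M}).mem_toFinset, _,
    if_neg h⟩

/-- If `y * K̂` is annihilated by all `M̂`, then `y * ε(H, K) = y * K̂`. -/
theorem mul_epsElt_of_forall {H K : Subgroup G} (h : K ≠ H) {y : MonoidAlgebra ℚ G}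
    (hy : ∀ M, IsMinimalNormalOver H K M → y * hatElt K * hatElt M = 0) :
    y * epsElt H K = y * hatElt K := by
  obtain ⟨S, hS, comm, he⟩ := epsElt_of_ne h
  rw [he, ← mul_assoc]
  refine Finset.noncommProd_induction _ _ comm (fun z => y * hatElt K * z = y * hatElt K)
    (fun z w hz hw => ?_) (mul_one _) (fun M hM => ?_)
  · rw [← mul_assoc, hz, hw]
  · rw [mul_sub, mul_one, hy M ((hS M).1 hM), sub_zero]

/-- The factors commute, so `1 - M̂` can be moved to the right end, where it meets the idempotent
`M̂`. -/
theorem epsElt_mul_hatElt {H K M : Subgroup G} (h : K ≠ H) (hM : IsMinimalNormalOver H K M) :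
    epsElt H K * hatElt M = 0 := by
  classical
  obtain ⟨S, hS, comm, he⟩ := epsElt_of_ne h
  have h0 : (1 - hatElt M) * hatElt M = 0 := by
    rw [sub_mul, one_mul, hatElt_mul_hatElt_of_le le_rfl, sub_self]
  rw [he, ← Finset.noncommProd_erase_mul _ ((hS M).2 hM), mul_assoc,
    mul_assoc, h0, mul_zero, mul_zero]

theorem map_epsElt {V : Type*} [Ring V] [Algebra ℚ V] (ψ : MonoidAlgebra ℚ G →ₐ[ℚ] V)
    {H K : Subgroup G} (h : K ≠ H) (hK : ψ (hatElt K) = 1)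
    (hM : ∀ M, IsMinimalNormalOver H K M → ψ (hatElt M) = 0) : ψ (epsElt H K) = 1 := by
  obtain ⟨S, hS, comm, he⟩ := epsElt_of_ne h
  rw [he, map_mul, hK, one_mul]
  refine Finset.noncommProd_induction _ _ comm (fun z => ψ z = 1)
    (fun z w hz hw => ?_) (map_one _) (fun M hM' => ?_)
  · rw [map_mul, hz, hw, one_mul]
  · rw [map_sub, map_one, hM M ((hS M).1 hM'), sub_zero]

theorem commute_epsElt {H K : Subgroup G} (h : K ≠ H) (hKn : K.Normal)
    (hM : ∀ M ≤ H, M.Normal) (x : MonoidAlgebra ℚ G) : Commute x (epsElt H K) := by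
  obtain ⟨S, hS, comm, he⟩ := epsElt_of_ne h
  rw [he]
  refine (commute_hatElt_of_normal hKn x).mul_right (Finset.noncommProd_commute _ _ _ _ ?_)
  intro M hM'
  exact (Commute.one_right x).sub_right
    (commute_hatElt_of_normal (hM M ((hS M).1 hM').1.1) x)

theorem hatElt_mul_epsElt {H K : Subgroup G} (h : K ≠ H) :
    hatElt K * epsElt H K = epsElt H K := by
  obtain ⟨S, hS, comm, he⟩ := epsElt_of_ne h
  rw [he, ← mul_assoc, hatElt_mul_hatElt_of_le le_rfl]

/-- A central element is its only conjugate, and the sum runs over distinct conjugates. -/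
theorem eElt_eq_epsElt {H K : Subgroup G} (h : ∀ x, Commute x (epsElt H K)) :
    eElt H K = epsElt H K := by
  have : Set.range (fun g : G => of ℚ G g⁻¹ * epsElt H K * of ℚ G g) = {epsElt H K} := by
    refine Set.eq_singleton_iff_unique_mem.2 ⟨⟨1, ?_⟩, ?_⟩
    · change of ℚ G 1⁻¹ * epsElt H K * of ℚ G 1 = _
      rw [inv_one, map_one, one_mul, mul_one]
    rintro _ ⟨g, rfl⟩
    change of ℚ G g⁻¹ * epsElt H K * of ℚ G g = _
    rw [(h _).eq, mul_assoc, ← map_mul, inv_mul_cancel, map_one, mul_one]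
  rw [eElt, this, finsum_mem_singleton]

end EpsElt

/-! ### ε(H, K) for a normal cyclic subgroup H, and cyclotomic polynomials -/

section CyclicNormal

variable {G : Type*} [Group G] [Finite G]

open MonoidAlgebra Polynomial

omit [Finite G] in
-- Conjugation by `g` sends `g₀` to some `g₀ ^ m`, hence acts on the whole cyclic group as the
-- `m`-th power map, which preserves every subgroup.
theorem normal_of_le_zpowers {g₀ : G} (hA : (Subgroup.zpowers g₀).Normal) {M : Subgroup G}
    (hM : M ≤ Subgroup.zpowers g₀) : M.Normal := by
  refine ⟨fun x hx g => ?_⟩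
  obtain ⟨t, rfl⟩ := Subgroup.mem_zpowers_iff.1 (hM hx)
  obtain ⟨m, hm⟩ := Subgroup.mem_zpowers_iff.1
    (hA.conj_mem g₀ (Subgroup.mem_zpowers g₀) g)
  rw [← conj_zpow, ← hm, zpow_comm]
  exact M.zpow_mem hx m

theorem exists_pow_of_mem_zpowers {g₀ x : G} (hx : x ∈ Subgroup.zpowers g₀) :
    ∃ t : ℕ, g₀ ^ t = x := mem_powers_iff_mem_zpowers.2 hx

/-- A polynomial over `ℚ` dividing `X ^ N - 1` and all `(X ^ N - 1) / (X ^ (N / q) - 1)`, for the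
primes `q` dividing `N`, divides the `N`-th cyclotomic polynomial. -/
theorem dvd_cyclotomic_of_forall {N : ℕ} (hN : 0 < N) {f : ℚ[X]} (h : f ∣ X ^ N - 1)
    (hq : ∀ q, q.Prime → q ∣ N → f ∣ ∑ j ∈ Finset.range q, (X ^ (N / q)) ^ j) :
    f ∣ cyclotomic N ℚ := by
  rw [← prod_cyclotomic_eq_X_pow_sub_one hN, ← Nat.insert_self_properDivisors hN.ne',
    Finset.prod_insert Nat.self_notMem_properDivisors] at h
  -- As `X ^ N - 1` is the product of the `Φ_m` with `m ∣ N`, it is enough that `f` is coprime to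
  -- `Φ_m` for every proper divisor `m`.
  refine IsCoprime.dvd_of_dvd_mul_right (IsCoprime.prod_right fun m hm => ?_) h
  obtain ⟨⟨c, hc⟩, hlt⟩ := Nat.mem_properDivisors.1 hm
  have hm0 : 0 < m := Nat.pos_of_ne_zero (by rintro rfl; simp at hc; omega)
  have hc1 : c ≠ 1 := by rintro rfl; omega
  -- For a prime `q` dividing `N / m`, `m` divides `N / q` and so `Φ_m` divides `X ^ (N / q) - 1`.
  -- Modulo the latter, the sum for `q` is the nonzero constant `q`.
  obtain ⟨q, hqp, d, hd⟩ := Nat.exists_prime_and_dvd hc1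
  have hNq : N / q = m * d := by
    rw [hc, hd, mul_left_comm, Nat.mul_div_cancel_left _ hqp.pos]
  have hqN : q ∣ N := ⟨m * d, by rw [hc, hd]; ring⟩
  have h1 : cyclotomic m ℚ ∣ X ^ (N / q) - 1 := by
    refine (cyclotomic.dvd_X_pow_sub_one m ℚ).trans ?_
    rw [hNq, pow_mul]
    simpa using sub_dvd_pow_sub_pow (X ^ m : ℚ[X]) 1 d
  refine IsCoprime.of_isCoprime_of_dvd_left (IsCoprime.of_isCoprime_of_dvd_right ?_ h1)
    (hq q hqp hqN)
  have h2 : (X ^ (N / q) - 1 : ℚ[X]) ∣ (∑ j ∈ Finset.range q, (X ^ (N / q)) ^ j) - (q : ℚ[X]) := by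
    have : (∑ j ∈ Finset.range q, (X ^ (N / q)) ^ j) - (q : ℚ[X]) =
        ∑ j ∈ Finset.range q, ((X ^ (N / q)) ^ j - 1) := by simp
    rw [this]
    refine Finset.dvd_sum fun j _ => ?_
    simpa using sub_dvd_pow_sub_pow (X ^ (N / q) : ℚ[X]) 1 j
  obtain ⟨r, hr⟩ := h2
  have hq0 : C ((q : ℚ)⁻¹) * (q : ℚ[X]) = 1 := by
    rw [← map_natCast C, ← C_mul, inv_mul_cancel₀ (Nat.cast_ne_zero.2 hqp.ne_zero), C_1]
  exact ⟨C ((q : ℚ)⁻¹), -C ((q : ℚ)⁻¹) * r, by linear_combination C ((q : ℚ)⁻¹) * hr + hq0⟩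

variable {g₀ : G} {K : Subgroup G} {N : ℕ}

omit [Finite G] in
theorem ne_zpowers_of_pow_mem_iff (hK : ∀ t : ℕ, g₀ ^ t ∈ K ↔ N ∣ t) (hN : 1 < N) :
    K ≠ Subgroup.zpowers g₀ := by
  rintro rfl
  exact absurd (Nat.dvd_one.1 ((hK 1).1 (by simp))) hN.ne'

/-- The polynomials `f` with `f(g₀) ε = 0` form an ideal, and its generator satisfies the hypotheses
of `dvd_cyclotomic_of_forall`. Indeed `g₀ ^ N ∈ K` is absorbed by `K̂`. For a prime `q ∣ N` and `s =
g₀ ^ (N / q)`, the element `(∑ s ^ j) K̂` is fixed by the subgroup `⟨K, s⟩`, which contains `K`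
properly and whose idempotent is annihilated by `ε`. -/
theorem aeval_cyclotomic_mul_epsElt (hA : (Subgroup.zpowers g₀).Normal)
    (hKA : K ≤ Subgroup.zpowers g₀) (hK : ∀ t : ℕ, g₀ ^ t ∈ K ↔ N ∣ t) (hN : 1 < N) :
    aeval (of ℚ G g₀) (cyclotomic N ℚ) * epsElt (Subgroup.zpowers g₀) K = 0 := by
  have hne := ne_zpowers_of_pow_mem_iff hK hN
  let e := epsElt (Subgroup.zpowers g₀) K
  have hnorm : ∀ M ≤ Subgroup.zpowers g₀, M.Normal := fun M hM => normal_of_le_zpowers hA hM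
  have hcomm : ∀ x, Commute x e := commute_epsElt hne (hnorm K hKA) hnorm
  have hKe : hatElt K * e = e := hatElt_mul_epsElt hne
  let J : Ideal ℚ[X] :=
    { carrier := {f | aeval (of ℚ G g₀) f * e = 0}
      zero_mem' := by simp
      add_mem' := fun {f g} (hf : _ = _) (hg : _ = _) => by
        change aeval (of ℚ G g₀) (f + g) * e = 0
        rw [map_add, add_mul, hf, hg, add_zero]
      smul_mem' := fun c f (hf : _ = _) => by
        change aeval (of ℚ G g₀) (c * f) * e = 0
        rw [map_mul, mul_assoc, hf, mul_zero] }
  have hJ : ∀ f, f ∈ J ↔ aeval (of ℚ G g₀) f * e = 0 := fun _ => Iff.rfl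
  have hdvd : ∀ f, f ∈ J ↔ Submodule.IsPrincipal.generator J ∣ f := fun f =>
    Submodule.IsPrincipal.mem_iff_generator_dvd J
  refine (hJ _).1 ((hdvd _).2 (dvd_cyclotomic_of_forall (by omega) ((hdvd _).1 ?_)
    fun q hq hqN => (hdvd _).1 ?_))
  · rw [hJ, map_sub, map_pow, aeval_X, map_one, ← map_pow, ← hKe, ← mul_assoc, sub_mul, one_mul,
      of_mul_hatElt ((hK N).2 dvd_rfl), sub_self, zero_mul]
  · rw [hJ, map_sum]
    simp only [map_pow, aeval_X]
    obtain ⟨s, hs⟩ : ∃ s, s = g₀ ^ (N / q) := ⟨_, rfl⟩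
    simp only [← map_pow, ← hs]
    have hsq : s ^ q ∈ K := by
      rw [hs, ← pow_mul, Nat.div_mul_cancel hqN]
      exact (hK N).2 dvd_rfl
    have hsK : s ∉ K := by
      rw [hs, hK]
      intro h
      have h1 : 0 < N / q := Nat.div_pos (Nat.le_of_dvd (by omega) hqN) hq.pos
      exact absurd (Nat.le_of_dvd h1 h) (not_le.2 (Nat.div_lt_self (by omega) hq.one_lt))
    let Mq := K ⊔ Subgroup.zpowers s
    have hMqA : Mq ≤ Subgroup.zpowers g₀ := by
      refine sup_le hKA ?_
      rw [Subgroup.zpowers_le, hs]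
      exact Subgroup.npow_mem_zpowers _ _
    have hKM : K < Mq := by
      refine lt_of_le_of_ne le_sup_left fun h => hsK ?_
      rw [h]
      exact (le_sup_right : _ ≤ Mq) (Subgroup.mem_zpowers s)
    have hnM := hnorm Mq hMqA
    -- A minimal `M` below `Mq` has its factor `1 - M̂` in `ε`, and `M̂` divides the idempotent of
    -- `Mq`.
    obtain ⟨M, hMle, hM⟩ := exists_minimal_le_of_wellFoundedLT
      (fun M : Subgroup G => M ≤ Subgroup.zpowers g₀ ∧ (M.subgroupOf (Subgroup.zpowers g₀)).Normal
        ∧ K < M) Mq ⟨hMqA, hnM.subgroupOf _, hKM⟩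
    have h0 : hatElt Mq * e = 0 := by
      have := epsElt_mul_hatElt hne hM
      rw [(hcomm _).eq, ← hatElt_mul_hatElt_of_le hMle, ← mul_assoc, this, zero_mul]
    let y := (∑ j ∈ Finset.range q, of ℚ G (s ^ j)) * hatElt K
    have hnK := hnorm K hKA
    have hy : hatElt Mq * y = y := by
      refine hatElt_mul_of_forall fun m hm => ?_
      -- The stabilizer of `y` is a subgroup, so it suffices that it contains `K` and `s`.
      let S : Subgroup G :=
        { carrier := {m | of ℚ G m * y = y}
          one_mem' := by
            change of ℚ G 1 * y = y
            rw [map_one, one_mul]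
          mul_mem' := fun {a b} (ha : _ = _) (hb : _ = _) => by
            change of ℚ G (a * b) * y = y
            rw [map_mul, mul_assoc, hb, ha]
          inv_mem' := fun {a} (ha : _ = _) => by
            change of ℚ G a⁻¹ * y = y
            conv_lhs => rw [← ha]
            rw [← mul_assoc, ← map_mul, inv_mul_cancel, map_one, one_mul] }
      refine (sup_le (fun m hm => ?_) ?_ : Mq ≤ S) hm
      · change of ℚ G m * y = y
        rw [show y = hatElt K * _ from (commute_hatElt_of_normal hnK _ : Commute _ _).eq,
          ← mul_assoc, of_mul_hatElt hm]
      · rw [Subgroup.zpowers_le]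
        change of ℚ G s * y = y
        -- Shifting the sum changes it by `s ^ q - 1`, which `K̂` annihilates.
        have h2 : of ℚ G s * ∑ j ∈ Finset.range q, of ℚ G (s ^ j) =
            (∑ j ∈ Finset.range q, of ℚ G (s ^ j)) + (of ℚ G (s ^ q) - 1) := by
          have h3 := Finset.sum_range_succ' (fun j => of ℚ G (s ^ j)) q
          rw [Finset.sum_range_succ] at h3
          rw [Finset.mul_sum]
          simp only [← map_mul, ← pow_succ']
          rw [pow_zero, map_one] at h3
          rw [add_sub, h3, add_sub_cancel_right]
        change of ℚ G s * (_ * hatElt K) = _ * hatElt K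
        rw [← mul_assoc, h2, add_mul, sub_mul, one_mul, of_mul_hatElt hsq, sub_self, add_zero]
    calc (∑ j ∈ Finset.range q, of ℚ G (s ^ j)) * e = y * e := by
          rw [show y * e = _ * hatElt K * e from rfl, mul_assoc, hKe]
      _ = hatElt Mq * y * e := by rw [hy]
      _ = y * (hatElt Mq * e) := by
          rw [← (commute_hatElt_of_normal hnM y).eq, mul_assoc]
      _ = 0 := by rw [h0, mul_zero]

/-- A representation that maps `g₀` to a primitive `N`-th root of unity of a field maps
`ε(⟨g₀⟩, K)` to `1`. -/
theorem map_epsElt_eq_one {L V : Type*} [Field L] [Ring V] [Algebra ℚ V]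
    (ψ : MonoidAlgebra ℚ G →ₐ[ℚ] V) (ι : L →+* V) {w : L} (hw : IsPrimitiveRoot w N)
    (hψ : ψ (of ℚ G g₀) = ι w)
    (hKA : K ≤ Subgroup.zpowers g₀) (hK : ∀ t : ℕ, g₀ ^ t ∈ K ↔ N ∣ t) (hN : 1 < N) :
    ψ (epsElt (Subgroup.zpowers g₀) K) = 1 := by
  have hpow : ∀ t : ℕ, ψ (of ℚ G (g₀ ^ t)) = ι (w ^ t) := fun t => by
    rw [map_pow, map_pow, hψ, map_pow]
  refine map_epsElt ψ (ne_zpowers_of_pow_mem_iff hK hN) (map_hatElt_eq_one ψ fun m hm => ?_)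
    fun M hM => ?_
  · obtain ⟨t, rfl⟩ := exists_pow_of_mem_zpowers (hKA hm)
    rw [hpow, (hw.pow_eq_one_iff_dvd t).2 ((hK t).1 hm), map_one]
  -- `M` contains some `g₀ ^ t` outside `K`; then `w ^ t ≠ 1`, and `w ^ t - 1` is invertible in the
  -- field.
  · obtain ⟨m, hmM, hmK⟩ := SetLike.exists_of_lt hM.1.2.2
    obtain ⟨t, rfl⟩ := exists_pow_of_mem_zpowers (hM.1.1 hmM)
    refine map_hatElt_eq_zero ψ hmM ?_
    rw [hpow, ← map_one ι, ← map_sub]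
    refine IsUnit.map ι (IsUnit.mk0 _ (sub_ne_zero.2 fun h => hmK ?_))
    exact (hK t).2 ((hw.pow_eq_one_iff_dvd t).1 h)

end CyclicNormal

/-! ### Split metacyclic groups and their representations in cyclic algebras -/

theorem isPrimitiveRoot_mul_of_coprime {M : Type*} [CommMonoid M] {x y : M} {m n : ℕ}
    (hx : IsPrimitiveRoot x m) (hy : IsPrimitiveRoot y n) (h : m.Coprime n) :
    IsPrimitiveRoot (x * y) (m * n) := by
  have hco : (orderOf x).Coprime (orderOf y) := by rwa [← hx.eq_orderOf, ← hy.eq_orderOf]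
  rw [IsPrimitiveRoot.iff_orderOf, (Commute.all _ _).orderOf_mul_eq_mul_orderOf_of_coprime hco,
    ← hx.eq_orderOf, ← hy.eq_orderOf]

/-- By the Chinese remainder theorem, suitable powers of `x * y` are `x` and `y`. -/
theorem zpowers_mul_eq_closure {G : Type*} [Group G] {x y : G} (hxy : Commute x y)
    (h : (orderOf x).Coprime (orderOf y)) :
    Subgroup.zpowers (x * y) = Subgroup.closure {x, y} := by
  refine le_antisymm ?_ ?_
  · rw [Subgroup.zpowers_le]
    exact mul_mem (Subgroup.subset_closure (by simp)) (Subgroup.subset_closure (by simp))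
  · rw [Subgroup.closure_le]
    rintro _ (rfl | rfl)
    · obtain ⟨t, h1, h2⟩ := Nat.chineseRemainder h 1 0
      refine Subgroup.mem_zpowers_iff.2 ⟨t, ?_⟩
      rw [zpow_natCast, hxy.mul_pow, pow_eq_pow_iff_modEq.2 h1, pow_eq_pow_iff_modEq.2 h2, pow_one,
        pow_zero, mul_one]
    · obtain ⟨t, h1, h2⟩ := Nat.chineseRemainder h 0 1
      refine Subgroup.mem_zpowers_iff.2 ⟨t, ?_⟩
      rw [zpow_natCast, hxy.mul_pow, pow_eq_pow_iff_modEq.2 h1, pow_eq_pow_iff_modEq.2 h2, pow_one,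
        pow_zero, one_mul]

theorem pow_mul_pow_mul_inv {H : Type*} [Group H] {x y : H} {s : ℕ}
    (h : y * x * y⁻¹ = x ^ s) (i j : ℕ) : y ^ j * x ^ i * (y ^ j)⁻¹ = x ^ (i * s ^ j) := by
  induction j with
  | zero => simp
  | succ j ih =>
    have h1 : y ^ (j + 1) * x ^ i * (y ^ (j + 1))⁻¹ = y * (y ^ j * x ^ i * (y ^ j)⁻¹) * y⁻¹ := by
      rw [pow_succ']
      group
    rw [h1, ih, ← conj_pow, h, ← pow_mul, pow_succ]
    ring_nf

/-- `G` is the semidirect product of the normal subgroup `⟨a⟩`, of order `p > 1`, and `⟨b⟩`, of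
order `d * k` prime to `p`, where `b ^ d` centralizes `a`. -/
structure IsSplitMetacyclic {G : Type*} [Group G] (a b : G) (p d k : ℕ) : Prop where
  one_lt : 1 < p
  orderOf_left : orderOf a = p
  orderOf_right : orderOf b = d * k
  coprime : p.Coprime (d * k)
  normal : (Subgroup.zpowers a).Normal
  compl : Subgroup.IsComplement' (Subgroup.zpowers a) (Subgroup.zpowers b)
  commute : Commute a (b ^ d)

namespace IsSplitMetacyclic

variable {G : Type*} [Group G] [Finite G] {a b : G} {p d k : ℕ}

theorem pos (hG : IsSplitMetacyclic a b p d k) : 0 < d * k := hG.orderOf_right ▸ orderOf_pos b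

theorem pos_left (hG : IsSplitMetacyclic a b p d k) : 0 < d := Nat.pos_of_mul_pos_right hG.pos

theorem pos_right (hG : IsSplitMetacyclic a b p d k) : 0 < k := Nat.pos_of_mul_pos_left hG.pos

theorem orderOf_pow (hG : IsSplitMetacyclic a b p d k) : orderOf (b ^ d) = k := by
  rw [orderOf_pow_of_dvd hG.pos_left.ne' (hG.orderOf_right ▸ dvd_mul_right d k), hG.orderOf_right,
    Nat.mul_div_cancel_left _ hG.pos_left]

omit [Finite G] in
theorem coprime_right (hG : IsSplitMetacyclic a b p d k) : p.Coprime k :=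
  hG.coprime.coprime_mul_left_right

theorem zpowers_mul_pow (hG : IsSplitMetacyclic a b p d k) :
    Subgroup.zpowers (a * b ^ d) = Subgroup.closure {a, b ^ d} := by
  refine zpowers_mul_eq_closure hG.commute ?_
  rw [hG.orderOf_left, hG.orderOf_pow]
  exact hG.coprime_right

theorem left_mem (hG : IsSplitMetacyclic a b p d k) : a ∈ Subgroup.zpowers (a * b ^ d) :=
  hG.zpowers_mul_pow ▸ Subgroup.subset_closure (by simp)

theorem right_pow_mem (hG : IsSplitMetacyclic a b p d k) : b ^ d ∈ Subgroup.zpowers (a * b ^ d) :=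
  hG.zpowers_mul_pow ▸ Subgroup.subset_closure (by simp)

theorem exists_eq_pow_mul_pow (hG : IsSplitMetacyclic a b p d k) (g : G) :
    ∃ i j : ℕ, g = a ^ i * b ^ j := by
  obtain ⟨⟨⟨x, hx⟩, ⟨y, hy⟩⟩, hxy⟩ := hG.compl.2 g
  obtain ⟨i, rfl⟩ := exists_pow_of_mem_zpowers hx
  obtain ⟨j, rfl⟩ := exists_pow_of_mem_zpowers hy
  exact ⟨i, j, hxy.symm⟩

/-- Divide the exponent of `b` by `d`: the quotient part is a power of `b ^ d`, which lies in the
cyclic group generated by `a * b ^ d`. -/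
theorem exists_eq_pow_mul_pow_lt (hG : IsSplitMetacyclic a b p d k) (g : G) :
    ∃ t i : ℕ, i < d ∧ g = (a * b ^ d) ^ t * b ^ i := by
  obtain ⟨i, j, rfl⟩ := hG.exists_eq_pow_mul_pow g
  obtain ⟨t, ht⟩ := exists_pow_of_mem_zpowers
    (mul_mem (pow_mem hG.left_mem i) (pow_mem hG.right_pow_mem (j / d)))
  refine ⟨t, j % d, Nat.mod_lt _ hG.pos_left, ?_⟩
  rw [ht, mul_assoc, ← pow_mul, ← pow_add, Nat.div_add_mod]

theorem commute_pow (hG : IsSplitMetacyclic a b p d k) (g : G) : Commute g (b ^ d) := by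
  obtain ⟨i, j, rfl⟩ := hG.exists_eq_pow_mul_pow g
  exact (hG.commute.pow_left i).mul_left (Commute.pow_pow_self b j d)

theorem normal_zpowers (hG : IsSplitMetacyclic a b p d k) :
    (Subgroup.zpowers (a * b ^ d)).Normal := by
  refine ⟨fun x hx g => ?_⟩
  obtain ⟨t, rfl⟩ := exists_pow_of_mem_zpowers hx
  have h := hG.normal.conj_mem _ (pow_mem (Subgroup.mem_zpowers a) t) g
  have h' : g * (a * b ^ d) ^ t * g⁻¹ = (g * a ^ t * g⁻¹) * (b ^ d) ^ t := by
    rw [hG.commute.mul_pow, ← mul_assoc, mul_assoc _ ((b ^ d) ^ t),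
      ((hG.commute_pow g⁻¹).pow_right t).symm.eq]
    group
  rw [h']
  refine mul_mem ?_ (pow_mem hG.right_pow_mem t)
  exact (Subgroup.zpowers_le.2 hG.left_mem) h

theorem zpowers_pow_le (hG : IsSplitMetacyclic a b p d k) (h : ℕ) :
    Subgroup.zpowers (b ^ (h * d)) ≤ Subgroup.zpowers (a * b ^ d) := by
  rw [Subgroup.zpowers_le, mul_comm, pow_mul]
  exact pow_mem hG.right_pow_mem h

omit [Finite G] in
theorem eq_one_of_mem (hG : IsSplitMetacyclic a b p d k) {g : G} (ha : g ∈ Subgroup.zpowers a)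
    (hb : g ∈ Subgroup.zpowers b) : g = 1 := by
  exact Subgroup.disjoint_def.1 hG.compl.disjoint ha hb

/-- The component in `⟨a⟩` must vanish, which gives `p ∣ t`; the component in `⟨b ^ d⟩`, cyclic of
order `k`, gives `h ∣ t`; and `p`, `h` are coprime. So `a * b ^ d` has order `p * h` modulo this
subgroup. -/
theorem pow_mem_iff (hG : IsSplitMetacyclic a b p d k) {h : ℕ} (hk : h ∣ k) (t : ℕ) :
    (a * b ^ d) ^ t ∈ Subgroup.zpowers (b ^ (h * d)) ↔ p * h ∣ t := by
  have hd : b ^ (h * d) = (b ^ d) ^ h := by rw [← pow_mul, mul_comm]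
  rw [hd, hG.commute.mul_pow]
  constructor
  · intro hm
    have hat : a ^ t = 1 := by
      refine hG.eq_one_of_mem (pow_mem (Subgroup.mem_zpowers a) t) ?_
      have h1 : Subgroup.zpowers ((b ^ d) ^ h) ≤ Subgroup.zpowers b := by
        rw [Subgroup.zpowers_le]
        exact pow_mem (pow_mem (Subgroup.mem_zpowers b) d) h
      refine (Subgroup.mul_mem_cancel_right _ ?_).1 (h1 hm)
      exact pow_mem (pow_mem (Subgroup.mem_zpowers b) d) t
    rw [hat, one_mul] at hm
    obtain ⟨m, hm⟩ := exists_pow_of_mem_zpowers hm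
    rw [← pow_mul, pow_eq_pow_iff_modEq, hG.orderOf_pow] at hm
    refine Nat.Coprime.mul_dvd_of_dvd_of_dvd (hG.coprime_right.coprime_dvd_right hk)
      (hG.orderOf_left ▸ orderOf_dvd_of_pow_eq_one hat) ?_
    exact (hm.dvd_iff hk).1 (dvd_mul_right h m)
  · rintro ⟨c, rfl⟩
    have hat : a ^ (p * h * c) = 1 := by
      rw [mul_assoc, pow_mul, ← hG.orderOf_left, pow_orderOf_eq_one, one_pow]
    rw [hat, one_mul, mul_comm p h, mul_assoc, pow_mul]
    exact pow_mem (Subgroup.mem_zpowers _) _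

/-- The three relations present `G`: homomorphisms on the two cyclic factors, compatible with
conjugation, glue by the universal property of the semidirect product. -/
theorem exists_monoidHom (hG : IsSplitMetacyclic a b p d k) {H : Type*} [Group H] {x y : H} {s : ℕ}
    (hab : b * a * b⁻¹ = a ^ s) (hx : x ^ p = 1) (hy : y ^ (d * k) = 1)
    (hxy : y * x * y⁻¹ = x ^ s) : ∃ f : G →* H, f a = x ∧ f b = y := by
  have := hG.normal
  let ga : Subgroup.zpowers a := ⟨a, Subgroup.mem_zpowers a⟩
  let gb : Subgroup.zpowers b := ⟨b, Subgroup.mem_zpowers b⟩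
  have hga : ∀ u, u ∈ Subgroup.zpowers ga := by
    rintro ⟨u, hu⟩
    obtain ⟨i, rfl⟩ := exists_pow_of_mem_zpowers hu
    exact Subgroup.mem_zpowers_iff.2 ⟨i, by rw [zpow_natCast]; rfl⟩
  have hgb : ∀ u, u ∈ Subgroup.zpowers gb := by
    rintro ⟨u, hu⟩
    obtain ⟨i, rfl⟩ := exists_pow_of_mem_zpowers hu
    exact Subgroup.mem_zpowers_iff.2 ⟨i, by rw [zpow_natCast]; rfl⟩
  have hoa : orderOf x ∣ orderOf ga := by
    rw [Subgroup.orderOf_mk, hG.orderOf_left]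
    exact orderOf_dvd_of_pow_eq_one hx
  have hob : orderOf y ∣ orderOf gb := by
    rw [Subgroup.orderOf_mk, hG.orderOf_right]
    exact orderOf_dvd_of_pow_eq_one hy
  let fa := monoidHomOfForallMemZpowers hga hoa
  let fb := monoidHomOfForallMemZpowers hgb hob
  have hfa : fa ga = x := monoidHomOfForallMemZpowers_apply_gen hga hoa
  have hfb : fb gb = y := monoidHomOfForallMemZpowers_apply_gen hgb hob
  let Φ := SemidirectProduct.mulEquivSubgroup hG.compl
  let F := SemidirectProduct.lift (φ := (Subgroup.zpowers a).normalizerMonoidHom.comp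
      (Subgroup.inclusion ((Subgroup.zpowers a).normalizer_eq_top ▸ le_top))) fa fb (by
    intro v
    refine MonoidHom.ext fun u => ?_
    obtain ⟨i, rfl⟩ := exists_pow_of_mem_zpowers (hga u)
    obtain ⟨j, rfl⟩ := exists_pow_of_mem_zpowers (hgb v)
    have h1 : ((Subgroup.zpowers a).normalizerMonoidHom.comp
        (Subgroup.inclusion ((Subgroup.zpowers a).normalizer_eq_top ▸ le_top))) (gb ^ j) (ga ^ i) =
        ga ^ (i * s ^ j) :=
      Subtype.ext (pow_mul_pow_mul_inv hab i j)
    refine (congrArg fa h1).trans ?_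
    change _ = fb (gb ^ j) * fa (ga ^ i) * (fb (gb ^ j))⁻¹
    rw [map_pow, map_pow, map_pow, hfa, hfb, pow_mul_pow_mul_inv hxy])
  have hΦ : ∀ (u : Subgroup.zpowers a) (v : Subgroup.zpowers b),
      Φ (SemidirectProduct.inl u * SemidirectProduct.inr v) = u * v := fun u v => by
    rw [← SemidirectProduct.mk_eq_inl_mul_inr]
    rfl
  refine ⟨F.comp Φ.symm.toMonoidHom, ?_, ?_⟩
  · have : Φ.symm a = SemidirectProduct.inl ga := by
      rw [MulEquiv.symm_apply_eq]
      simpa [ga] using (hΦ ga 1).symm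
    change F (Φ.symm a) = x
    rw [this, SemidirectProduct.lift_inl, hfa]
  · have : Φ.symm b = SemidirectProduct.inr gb := by
      rw [MulEquiv.symm_apply_eq]
      simpa [gb] using (hΦ 1 gb).symm
    change F (Φ.symm b) = y
    rw [this, SemidirectProduct.lift_inr, hfb]

open MonoidAlgebra Polynomial in
theorem exists_eq_sum (hG : IsSplitMetacyclic a b p d k) (x : MonoidAlgebra ℚ G) :
    ∃ f : ℕ → ℚ[X], x = ∑ i ∈ Finset.range d,
      aeval (of ℚ G (a * b ^ d)) (f i) * of ℚ G b ^ i := by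
  induction x using MonoidAlgebra.induction_on with
  | of g =>
    obtain ⟨t, i, hi, rfl⟩ := hG.exists_eq_pow_mul_pow_lt g
    refine ⟨Pi.single i (X ^ t), ?_⟩
    rw [Finset.sum_eq_single i]
    · rw [Pi.single_eq_same, map_pow, aeval_X, map_mul, map_pow, map_pow]
    · intro j _ hj
      rw [Pi.single_eq_of_ne hj, map_zero, zero_mul]
    · exact fun h => absurd (Finset.mem_range.2 hi) h
  | add x y hx hy =>
    obtain ⟨f, rfl⟩ := hx
    obtain ⟨g, rfl⟩ := hy
    exact ⟨f + g, by simp [add_mul, Finset.sum_add_distrib]⟩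
  | smul r x hx =>
    obtain ⟨f, rfl⟩ := hx
    exact ⟨fun i => r • f i, by simp [Finset.smul_sum]⟩

theorem commute_epsElt (hG : IsSplitMetacyclic a b p d k) {h : ℕ} (hk : h ∣ k)
    (x : MonoidAlgebra ℚ G) :
    Commute x (epsElt (Subgroup.zpowers (a * b ^ d)) (Subgroup.zpowers (b ^ (h * d)))) := by
  have hpos : 0 < h := Nat.pos_of_dvd_of_pos hk hG.pos_right
  have h1 : 1 < p * h := lt_of_lt_of_le hG.one_lt (Nat.le_mul_of_pos_right p hpos)
  exact _root_.commute_epsElt (ne_zpowers_of_pow_mem_iff (hG.pow_mem_iff hk) h1)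
    (normal_of_le_zpowers hG.normal_zpowers (hG.zpowers_pow_le h))
    (fun M hM => normal_of_le_zpowers hG.normal_zpowers hM) x

section Representation

variable {E L : Type*} [Field E] [Field L] [Algebra E L] [FiniteDimensional E L]
    [Algebra ℚ E] [Algebra ℚ L] [IsScalarTower ℚ E L]
    (σ : L ≃ₐ[E] L) (hσ : ∀ g, g ∈ Subgroup.zpowers σ) (z : Eˣ)

open MonoidAlgebra Polynomial CrossedProduct

/-- The representation of `G` in the cyclic algebra `(L/E, z)`, where `z` is a primitive `h`-th root
of unity. -/
theorem exists_algHom (hG : IsSplitMetacyclic a b p d k) {h s : ℕ} (hk : h ∣ k)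
    (hab : b * a * b⁻¹ = a ^ s) {ω : L} (hω : IsPrimitiveRoot ω p)
    (hz : IsPrimitiveRoot (algebraMap E L z) h) (hσω : σ ω = ω ^ s) (hd : orderOf σ = d)
    (hL : Algebra.adjoin ℚ {ω * algebraMap E L z} = ⊤) :
    ∃ ψ : MonoidAlgebra ℚ G →ₐ[ℚ] CyclicAlgebra σ hσ z, Function.Surjective ψ ∧
      ψ (epsElt (Subgroup.zpowers (a * b ^ d)) (Subgroup.zpowers (b ^ (h * d)))) = 1 ∧
      ∀ x, ψ x = 0 →
        x * epsElt (Subgroup.zpowers (a * b ^ d)) (Subgroup.zpowers (b ^ (h * d))) = 0 := by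
  have hpos : 0 < h := Nat.pos_of_dvd_of_pos hk hG.pos_right
  have h1 : 1 < p * h := lt_of_lt_of_le hG.one_lt (Nat.le_mul_of_pos_right p hpos)
  have : CharZero L := algebraRat.charZero L
  let ι := ofField (FactorSet.cyclic σ hσ z)
  let u := CyclicAlgebra.gen σ hσ z
  have hud : u ^ d = ι (algebraMap E L z) := hd ▸ CyclicAlgebra.gen_pow_orderOf σ hσ z
  have hx : (ι ω) ^ p = 1 := by rw [← map_pow, hω.pow_eq_one, map_one]
  have hy : u ^ (d * k) = 1 := by
    rw [pow_mul, hud, ← map_pow, (hz.pow_eq_one_iff_dvd k).2 hk, map_one]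
  let x' := Units.ofPowEqOne (ι ω) p hx (by have := hG.one_lt; omega)
  let y' := Units.ofPowEqOne u (d * k) hy hG.pos.ne'
  have hx' : (x' : CyclicAlgebra σ hσ z) = ι ω := rfl
  have hy' : (y' : CyclicAlgebra σ hσ z) = u := rfl
  obtain ⟨f, hfa, hfb⟩ := hG.exists_monoidHom (x := x') (y := y') hab
    (Units.ext (by rw [Units.val_pow_eq_pow_val, hx', hx, Units.val_one]))
    (Units.ext (by rw [Units.val_pow_eq_pow_val, hy', hy, Units.val_one]))
    (by
      rw [mul_inv_eq_iff_eq_mul]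
      refine Units.ext ?_
      rw [Units.val_mul, Units.val_mul, Units.val_pow_eq_pow_val, hx', hy', ← map_pow, ← hσω]
      exact CyclicAlgebra.gen_mul_ofField σ hσ z ω)
  let ψ : MonoidAlgebra ℚ G →ₐ[ℚ] CyclicAlgebra σ hσ z :=
    MonoidAlgebra.lift ℚ _ G ((Units.coeHom _).comp f)
  have hψ : ∀ g, ψ (of ℚ G g) = f g := fun g => MonoidAlgebra.lift_of _ _
  have hψb : ψ (of ℚ G b) = u := by rw [hψ, hfb, hy']
  have hψg : ψ (of ℚ G (a * b ^ d)) = ι (ω * algebraMap E L z) := by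
    rw [map_mul, map_pow, map_mul, map_pow, hψb, hud, hψ, hfa, hx', map_mul]
  have hw : IsPrimitiveRoot (ω * algebraMap E L z) (p * h) :=
    isPrimitiveRoot_mul_of_coprime hω hz (hG.coprime_right.coprime_dvd_right hk)
  have hψf : ∀ q : ℚ[X], ψ (aeval (of ℚ G (a * b ^ d)) q) =
      ι (aeval (ω * algebraMap E L z) q) := by
    intro q
    rw [← aeval_algHom_apply, hψg]
    exact aeval_algHom_apply ι.toRatAlgHom _ q
  refine ⟨ψ, fun v => ?_, ?_, fun x hx => ?_⟩
  · obtain ⟨c, rfl⟩ := CyclicAlgebra.exists_eq_sum σ hσ z v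
    have hc : ∀ i, ∃ q : ℚ[X], aeval (ω * algebraMap E L z) q = c i := fun i => by
      have : c i ∈ Algebra.adjoin ℚ {ω * algebraMap E L z} := hL ▸ Algebra.mem_top
      rwa [Algebra.adjoin_singleton_eq_range_aeval] at this
    choose q hq using hc
    refine ⟨∑ i ∈ Finset.range d, aeval (of ℚ G (a * b ^ d)) (q i) * of ℚ G b ^ i, ?_⟩
    rw [map_sum, hd]
    refine Finset.sum_congr rfl fun i _ => ?_
    rw [map_mul, map_pow, hψf, hψb, hq]
  · exact map_epsElt_eq_one ψ ι hw hψg (hG.zpowers_pow_le h) (hG.pow_mem_iff hk) h1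
  · obtain ⟨q, rfl⟩ := hG.exists_eq_sum x
    rw [map_sum] at hx
    simp only [map_mul ψ, map_pow ψ, hψf, hψb] at hx
    rw [Finset.sum_mul]
    refine Finset.sum_eq_zero fun i hi => ?_
    -- The powers of `u` below `d` are independent over `L`, so each coefficient vanishes.
    have h0 : aeval (ω * algebraMap E L z) (q i) = 0 := by
      have := CyclicAlgebra.coeff_sum σ hσ z (fun i => aeval (ω * algebraMap E L z) (q i))
        (hd.symm ▸ Finset.mem_range.1 hi)
      rw [← this, hd]
      exact congrArg (fun v => CrossedProduct.coeff v _) hx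
    obtain ⟨r, hr⟩ : cyclotomic (p * h) ℚ ∣ q i := by
      have hmin : cyclotomic (p * h) ℚ = minpoly ℚ (ω * algebraMap E L z) := by
        -- The given `ℚ`-algebra structure on `L` and the canonical one coincide, being unique.
        convert cyclotomic_eq_minpoly_rat hw (by omega)
        exact Subsingleton.elim _ _
      rw [hmin]
      exact minpoly.dvd _ _ h0
    have hcomm := hG.commute_epsElt hk (of ℚ G b ^ i)
    have hcyc := aeval_cyclotomic_mul_epsElt hG.normal_zpowers (hG.zpowers_pow_le h)
      (hG.pow_mem_iff hk) h1
    rw [mul_assoc, hcomm.eq, ← mul_assoc, hr, mul_comm (cyclotomic _ _), map_mul,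
      mul_assoc (aeval (of ℚ G (a * b ^ d)) r), hcyc, mul_zero, zero_mul]

end Representation

end IsSplitMetacyclic

/-! ### The ideal R e and a surjection onto a simple ring -/

section Component

variable {R V : Type*} [Ring R] [Algebra ℚ R] [Ring V] [Algebra ℚ V] {e : R}

/-- As `ψ(x e) = ψ(x)`, the restriction of `ψ` to `R e` is still onto, and `ψ(x e) = 0` forces `x e
= 0`. -/
theorem exists_componentOf_linearEquiv (ψ : R →ₐ[ℚ] V) (hψ : Function.Surjective ψ) (he : ψ e = 1)
    (h0 : ∀ x, ψ x = 0 → x * e = 0) :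
    ∃ φ : componentOf e ≃ₗ[ℚ] V, ∀ x y, φ (x * y) = φ x * φ y := by
  let F : componentOf e →ₗ[ℚ] V :=
    { toFun := fun x => ψ x
      map_add' := fun x y => map_add ψ (x : R) y
      map_smul' := fun r x => map_smul ψ r (x : R) }
  refine ⟨LinearEquiv.ofBijective F ⟨?_, fun v => ?_⟩, fun x y => map_mul ψ (x : R) y⟩
  · rw [injective_iff_map_eq_zero]
    rintro ⟨_, x, rfl⟩ hx
    refine Subtype.ext (h0 x ?_)
    have : ψ (x * e) = 0 := hx
    rwa [map_mul, he, mul_one] at this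
  · obtain ⟨x, rfl⟩ := hψ v
    refine ⟨⟨x * e, x, rfl⟩, ?_⟩
    change ψ (x * e) = ψ x
    rw [map_mul, he, mul_one]

/-- The two-sided ideal generated by a central element. -/
def centralIdeal (he : ∀ x, Commute x e) : TwoSidedIdeal R :=
  TwoSidedIdeal.mk' (Set.range fun x => x * e) ⟨0, zero_mul e⟩
    (by rintro _ _ ⟨x, rfl⟩ ⟨y, rfl⟩; exact ⟨x + y, add_mul x y e⟩)
    (by rintro _ ⟨x, rfl⟩; exact ⟨-x, neg_mul x e⟩)
    (by rintro x _ ⟨y, rfl⟩; exact ⟨x * y, mul_assoc x y e⟩)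
    (by
      rintro _ y ⟨x, rfl⟩
      refine ⟨x * y, ?_⟩
      change x * y * e = x * e * y
      rw [mul_assoc, (he y).eq, mul_assoc])

omit [Algebra ℚ R] in
theorem mem_centralIdeal (he : ∀ x, Commute x e) {x : R} :
    x ∈ centralIdeal he ↔ ∃ y, y * e = x := TwoSidedIdeal.mem_mk' _ _ _ _ _ _ _

/-- A nonzero ideal inside `R e` has nonzero image, which is an ideal of `V` and so contains 1; a
preimage `y` of 1 in it satisfies `y e = e`. -/
theorem isAtom_centralIdeal [Nontrivial V] (hc : ∀ x, Commute x e) (ψ : R →ₐ[ℚ] V)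
    (hψ : Function.Surjective ψ) (he : ψ e = 1) (h0 : ∀ x, ψ x = 0 → x * e = 0)
    (hV : ∀ (I : TwoSidedIdeal V) (f : V), f ∈ I → f ≠ 0 → 1 ∈ I) :
    IsAtom (centralIdeal hc) := by
  have hne : e ≠ 0 := by
    rintro rfl
    exact zero_ne_one ((map_zero ψ).symm.trans he)
  refine ⟨fun h => hne ?_, fun J hJ => ?_⟩
  · have : e ∈ centralIdeal hc := (mem_centralIdeal hc).2 ⟨1, one_mul e⟩
    rwa [h, TwoSidedIdeal.mem_bot] at this
  · by_contra hJ0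
    obtain ⟨x, hxJ, hx0⟩ : ∃ x ∈ J, x ≠ 0 := by
      by_contra! h
      exact hJ0 (eq_bot_iff.2 fun x hx => (TwoSidedIdeal.mem_bot R).2 (h x hx))
    let I : TwoSidedIdeal V := TwoSidedIdeal.mk' (ψ '' {x | x ∈ J}) ⟨0, J.zero_mem, map_zero ψ⟩
      (by
        rintro _ _ ⟨x, hx, rfl⟩ ⟨y, hy, rfl⟩
        exact ⟨x + y, J.add_mem hx hy, map_add ψ x y⟩)
      (by rintro _ ⟨x, hx, rfl⟩; exact ⟨-x, J.neg_mem hx, map_neg ψ x⟩)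
      (by
        rintro v _ ⟨x, hx, rfl⟩
        obtain ⟨y, rfl⟩ := hψ v
        exact ⟨y * x, J.mul_mem_left _ _ hx, map_mul ψ y x⟩)
      (by
        rintro _ v ⟨x, hx, rfl⟩
        obtain ⟨y, rfl⟩ := hψ v
        exact ⟨x * y, J.mul_mem_right _ _ hx, map_mul ψ x y⟩)
    have hI : ∀ v, v ∈ I ↔ ∃ x ∈ J, ψ x = v := fun v => TwoSidedIdeal.mem_mk' _ _ _ _ _ _ _
    have hψx : ψ x ≠ 0 := by
      intro h
      obtain ⟨y, rfl⟩ := (mem_centralIdeal hc).1 (hJ.le hxJ)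
      rw [map_mul, he, mul_one] at h
      exact hx0 (h0 y h)
    obtain ⟨y, hyJ, hy⟩ := (hI 1).1 (hV I (ψ x) ((hI _).2 ⟨x, hxJ, rfl⟩) hψx)
    have hye : y * e = e := by
      have := h0 (y - 1) (by rw [map_sub, hy, map_one, sub_self])
      rwa [sub_mul, one_mul, sub_eq_zero] at this
    have heJ : e ∈ J := hye ▸ J.mul_mem_right _ _ hyJ
    refine hJ.not_ge fun w hw => ?_
    obtain ⟨v, rfl⟩ := (mem_centralIdeal hc).1 hw
    exact J.mul_mem_left _ _ heJ

theorem coe_componentOf_eq (he : ∀ x, Commute x e) :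
    (componentOf e : Set R) = {x | x ∈ centralIdeal he} :=
  Set.ext fun _ => (mem_centralIdeal he).symm

end Component

/-! ### Non-commutativity of cyclic algebras -/

namespace CyclicAlgebra

open CrossedProduct

variable {E L : Type*} [Field E] [Field L] [Algebra E L] [FiniteDimensional E L]
    (σ : L ≃ₐ[E] L) (hσ : ∀ g, g ∈ Subgroup.zpowers σ) (a : Eˣ)

theorem nontrivial : Nontrivial (CyclicAlgebra σ hσ a) := by
  refine ⟨⟨0, mono _ 1 1, fun h => ?_⟩⟩
  have := congrArg (fun f => coeff f 1) h
  simp only [coeff_mono_self, coeff_zero] at this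
  exact zero_ne_one this

theorem exists_mul_ne_mul (h : orderOf σ ≠ 1) :
    ∃ f g : CyclicAlgebra σ hσ a, f * g ≠ g * f := by
  obtain ⟨x, hx⟩ : ∃ x, σ x ≠ x := by
    by_contra! h'
    exact h (orderOf_eq_one_iff.2 (AlgEquiv.ext h'))
  refine ⟨mono _ σ 1, ofField _ x, fun h' => hx ?_⟩
  have := congrArg (fun f => coeff f σ) h'
  simpa only [coeff_ofField_mul, coeff_mul_ofField, coeff_mono_self, one_mul, mul_one] using this

end CyclicAlgebra

/-! ### There are no other non-commutative components -/

theorem exists_dvd_eq_zpowers {G : Type*} [Group G] [Finite G] {c : G} {M : Subgroup G}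
    (hM : M ≤ Subgroup.zpowers c) : ∃ h, h ∣ orderOf c ∧ M = Subgroup.zpowers (c ^ h) := by
  have := isCyclic_of_injective (Subgroup.inclusion hM) (Subgroup.inclusion_injective hM)
  obtain ⟨⟨y, hy⟩, hgen⟩ := IsCyclic.exists_generator (α := M)
  obtain ⟨m, rfl⟩ := exists_pow_of_mem_zpowers (x := y) (hM hy)
  refine ⟨m.gcd (orderOf c), Nat.gcd_dvd_right _ _, le_antisymm (fun x hx => ?_) ?_⟩
  · obtain ⟨t, ht⟩ := exists_pow_of_mem_zpowers (hgen (⟨x, hx⟩ : M))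
    have ht' : (c ^ m) ^ t = x := congrArg Subtype.val ht
    have hm : c ^ m ∈ Subgroup.zpowers (c ^ m.gcd (orderOf c)) := by
      obtain ⟨r, hr⟩ := Nat.gcd_dvd_left m (orderOf c)
      exact Subgroup.mem_zpowers_iff.2 ⟨r, by rw [zpow_natCast, ← pow_mul, ← hr]⟩
    exact ht' ▸ pow_mem hm t
  · rw [Subgroup.zpowers_le, ← zpow_natCast, Nat.gcd_eq_gcd_ab, zpow_add, zpow_mul, zpow_mul,
      zpow_natCast, zpow_natCast, pow_orderOf_eq_one, one_zpow, mul_one]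
    exact zpow_mem hy _

theorem dvd_of_pow_mem_zpowers {G : Type*} [Group G] [Finite G] {c : G} {h t : ℕ}
    (hc : h ∣ orderOf c) (ht : c ^ t ∈ Subgroup.zpowers (c ^ h)) : h ∣ t := by
  obtain ⟨m, hm⟩ := exists_pow_of_mem_zpowers ht
  rw [← pow_mul, pow_eq_pow_iff_modEq] at hm
  exact (hm.dvd_iff hc).1 (dvd_mul_right h m)

namespace IsSplitMetacyclic

open MonoidAlgebra

variable {G : Type*} [Group G] [Finite G] {a b : G} {p d k : ℕ}

/-- If `M` contains `(a b^d)^t` with `p ∤ t`, the `k`-th power of this element is `a ^ (t k)`, a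
generator of `⟨a⟩`. Otherwise all exponents are divisible by `p` and the `a`-part disappears. -/
theorem left_mem_or_le (hG : IsSplitMetacyclic a b p d k) (hp : p.Prime) {M : Subgroup G}
    (hM : M ≤ Subgroup.zpowers (a * b ^ d)) : a ∈ M ∨ M ≤ Subgroup.zpowers (b ^ d) := by
  by_cases h : ∃ t : ℕ, (a * b ^ d) ^ t ∈ M ∧ ¬ p ∣ t
  · obtain ⟨t, htM, htp⟩ := h
    left
    have h1 : a ^ (t * k) ∈ M := by
      have := pow_mem htM k
      rwa [← pow_mul, hG.commute.mul_pow, mul_comm t k, pow_mul (b ^ d), ← hG.orderOf_pow,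
        pow_orderOf_eq_one, one_pow, mul_one, hG.orderOf_pow, mul_comm k t] at this
    have h2 : (orderOf a).Coprime (t * k) := by
      rw [hG.orderOf_left]
      exact ((hp.coprime_iff_not_dvd).2 htp).mul_right hG.coprime_right
    obtain ⟨m, hm⟩ := exists_pow_eq_self_of_coprime h2.symm
    exact hm ▸ pow_mem h1 m
  · push Not at h
    right
    intro x hx
    obtain ⟨t, rfl⟩ := exists_pow_of_mem_zpowers (hM hx)
    obtain ⟨c, hc⟩ := h t hx
    have hat : a ^ t = 1 := by
      rw [hc, pow_mul, ← hG.orderOf_left, pow_orderOf_eq_one, one_pow]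
    rw [hG.commute.mul_pow, hat, one_mul]
    exact pow_mem (Subgroup.mem_zpowers _) t

/-- The idempotents `ε(⟨a, b ^ d⟩, ⟨b ^ (h * d)⟩)`, `h ∣ k`, generate the ideal
`ℚG (1 - Ĥ)`, where `H = ⟨a⟩`. -/
theorem eq_mul_hatElt (hG : IsSplitMetacyclic a b p d k) (hp : p.Prime) {x : MonoidAlgebra ℚ G}
    (hx : ∀ h, h ∣ k →
      x * epsElt (Subgroup.zpowers (a * b ^ d)) (Subgroup.zpowers (b ^ (h * d))) = 0) :
    x = x * hatElt (Subgroup.zpowers a) := by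
  obtain ⟨z, hz⟩ : ∃ z, z = x - x * hatElt (Subgroup.zpowers a) := ⟨_, rfl⟩
  have hza : ∀ M : Subgroup G, a ∈ M → z * hatElt M = 0 := fun M hM => by
    rw [hz, sub_mul, mul_assoc, hatElt_mul_hatElt_of_le (Subgroup.zpowers_le.2 hM), sub_self]
  have hze : ∀ h, h ∣ k →
      z * epsElt (Subgroup.zpowers (a * b ^ d)) (Subgroup.zpowers (b ^ (h * d))) = 0 := by
    intro h hk
    rw [hz, sub_mul, mul_assoc, (hG.commute_epsElt hk (hatElt _)).eq, ← mul_assoc, hx h hk, zero_mul,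
      sub_zero]
  have hb : ∀ h, b ^ (h * d) = (b ^ d) ^ h := fun h => by rw [← pow_mul, mul_comm]
  -- Put `K = ⟨b ^ (h d)⟩`. A minimal `M` above `K` either contains `a`, so `z M̂ = 0` by the choice
  -- of `z`, or is `⟨b ^ (h' d)⟩` for a proper divisor `h'` of `h`, so `z M̂ = 0` by induction.
  -- Hence `z K̂ = z ε(A, K) = 0`.
  have key : ∀ h, h ∣ k → z * hatElt (Subgroup.zpowers (b ^ (h * d))) = 0 := by
    intro h
    induction h using Nat.strong_induction_on with
    | _ h ih =>
    intro hk
    have h1 : 1 < p * h := lt_of_lt_of_le hG.one_lt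
      (Nat.le_mul_of_pos_right p (Nat.pos_of_dvd_of_pos hk hG.pos_right))
    rw [← mul_epsElt_of_forall (ne_zpowers_of_pow_mem_iff (hG.pow_mem_iff hk) h1), hze h hk]
    intro M hM
    rw [mul_assoc, hatElt_mul_hatElt_of_le hM.1.2.2.le]
    obtain haM | hMle := hG.left_mem_or_le hp hM.1.1
    · exact hza M haM
    · obtain ⟨h', hh', rfl⟩ := exists_dvd_eq_zpowers hMle
      have hlt := hM.1.2.2
      rw [hb] at hlt
      have hdvd : h' ∣ h := dvd_of_pow_mem_zpowers hh' (hlt.le (Subgroup.mem_zpowers _))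
      have hne : h' ≠ h := by
        rintro rfl
        exact lt_irrefl _ hlt
      have hpos : 0 < h := Nat.pos_of_dvd_of_pos hk hG.pos_right
      rw [← hb]
      exact ih h' (lt_of_le_of_ne (Nat.le_of_dvd hpos hdvd) hne) (hG.orderOf_pow ▸ hh')
  -- For `h = k` the subgroup is trivial, and `key` says `z = 0`.
  have hk1 : hatElt (Subgroup.zpowers (b ^ (k * d))) = 1 := by
    rw [← mul_one (hatElt _)]
    refine hatElt_mul_of_forall fun m hm => ?_
    rw [hb, ← hG.orderOf_pow, pow_orderOf_eq_one, Subgroup.zpowers_one_eq_bot,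
      Subgroup.mem_bot] at hm
    rw [hm, map_one, one_mul]
  have := key k dvd_rfl
  rw [hk1, mul_one, hz, sub_eq_zero] at this
  exact this

/-- `G/⟨a⟩` is generated by the image of `b`, so `g g'` and `g' g` differ by an element of `⟨a⟩`,
which the idempotent absorbs. -/
theorem mul_mul_hatElt_comm (hG : IsSplitMetacyclic a b p d k) (x y : MonoidAlgebra ℚ G) :
    x * y * hatElt (Subgroup.zpowers a) = y * x * hatElt (Subgroup.zpowers a) := by
  have hn := hG.normal
  have hmk : ∀ g : G, ∃ j : ℕ, (g : G ⧸ Subgroup.zpowers a) = (b : G ⧸ Subgroup.zpowers a) ^ j := by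
    intro g
    obtain ⟨i, j, rfl⟩ := hG.exists_eq_pow_mul_pow g
    refine ⟨j, ?_⟩
    rw [QuotientGroup.mk_mul, QuotientGroup.mk_pow, QuotientGroup.mk_pow,
      (QuotientGroup.eq_one_iff a).2 (Subgroup.mem_zpowers a), one_pow, one_mul]
  induction x using MonoidAlgebra.induction_on with
  | add x x' hx hx' => simp only [add_mul, mul_add, hx, hx']
  | smul r x hx => simp only [smul_mul_assoc, mul_smul_comm, hx]
  | of g =>
  induction y using MonoidAlgebra.induction_on with
  | add x x' hx hx' => simp only [add_mul, mul_add, hx, hx']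
  | smul r x hx => simp only [smul_mul_assoc, mul_smul_comm, hx]
  | of g' =>
  have hmem : (g' * g)⁻¹ * (g * g') ∈ Subgroup.zpowers a := by
    refine QuotientGroup.eq.1 ?_
    obtain ⟨j, hj⟩ := hmk g
    obtain ⟨j', hj'⟩ := hmk g'
    rw [QuotientGroup.mk_mul, QuotientGroup.mk_mul, hj, hj', ← pow_add, ← pow_add, add_comm]
  rw [← map_mul, ← map_mul]
  conv_rhs => rw [← of_mul_hatElt hmem]
  rw [← mul_assoc, ← map_mul, mul_inv_cancel_left]

end IsSplitMetacyclic

/-! ### Subgroups of cyclic groups and subfields of cyclic extensions -/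

section CyclicGroup

variable {Γ : Type*} [Group Γ] [Finite Γ] [IsCyclic Γ]

/-- A subgroup of order `m` lies in the kernel of `x ↦ x ^ m`, which itself has exactly `m`
elements. -/
theorem IsCyclic.existsUnique_subgroup {m : ℕ} (hm : m ∣ Nat.card Γ) :
    ∃! H : Subgroup Γ, Nat.card H = m := by
  let _ : CommGroup Γ := IsCyclic.commGroup
  have hcard : Nat.card (powMonoidHom m : Γ →* Γ).ker = m := by
    rw [IsCyclic.card_powMonoidHom_ker, Nat.gcd_eq_right hm]
  refine ⟨(powMonoidHom m : Γ →* Γ).ker, hcard, fun H hH => ?_⟩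
  refine Subgroup.eq_of_le_of_card_ge (fun x hx => ?_) (by rw [hcard, hH])
  rw [MonoidHom.mem_ker, powMonoidHom_apply]
  have := pow_card_eq_one' (x := (⟨x, hx⟩ : H))
  rw [hH] at this
  exact congrArg Subtype.val this

theorem IsCyclic.mem_zpowers_of_orderOf_eq {x y : Γ} (h : orderOf x = orderOf y) :
    x ∈ Subgroup.zpowers y := by
  have := (IsCyclic.existsUnique_subgroup (orderOf_dvd_natCard y)).unique
    (y₁ := Subgroup.zpowers x) (y₂ := Subgroup.zpowers y)
    (by rw [Nat.card_zpowers, h]) (by rw [Nat.card_zpowers])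
  exact this ▸ Subgroup.mem_zpowers x

end CyclicGroup

section Galois

theorem existsUnique_intermediateField_finrank {K L : Type*} [Field K] [Field L] [Algebra K L]
    [FiniteDimensional K L] [IsGalois K L] [IsCyclic (L ≃ₐ[K] L)] {m : ℕ}
    (hm : m ∣ Module.finrank K L) :
    ∃! F : IntermediateField K L, Module.finrank K F = m := by
  obtain ⟨c, hc⟩ := hm
  have hpos : 0 < m * c := hc ▸ Module.finrank_pos
  have hcpos : 0 < c := Nat.pos_of_mul_pos_left hpos
  have hcard : Nat.card (L ≃ₐ[K] L) = m * c := by rw [IsGalois.card_aut_eq_finrank, hc]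
  obtain ⟨H, hH, huniq⟩ := IsCyclic.existsUnique_subgroup (Γ := L ≃ₐ[K] L) (m := c)
    (hcard ▸ dvd_mul_left c m)
  have hfix : ∀ F : IntermediateField K L,
      Module.finrank K F = m ↔ Nat.card F.fixingSubgroup = c := by
    intro F
    have h1 := Module.finrank_mul_finrank K F L
    rw [hc] at h1
    rw [IsGalois.card_fixingSubgroup_eq_finrank]
    constructor
    · intro h
      rw [h] at h1
      exact Nat.eq_of_mul_eq_mul_left (Nat.pos_of_mul_pos_right hpos) h1
    · intro h
      rw [h] at h1
      exact Nat.eq_of_mul_eq_mul_right hcpos h1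
  refine ⟨IntermediateField.fixedField H, ?_, fun F hF => ?_⟩
  · change Module.finrank K (IntermediateField.fixedField H) = m
    rw [hfix, IntermediateField.fixingSubgroup_fixedField, hH]
  · rw [← huniq _ ((hfix F).1 hF), IsGalois.fixedField_fixingSubgroup]

variable {K M : Type*} [Field K] [Field M] [Algebra K M]

theorem existsUnique_le_finrank (P : IntermediateField K M)
    [FiniteDimensional K P] [IsGalois K P] [IsCyclic (P ≃ₐ[K] P)] {m : ℕ}
    (hm : m ∣ Module.finrank K P) :
    ∃! F : IntermediateField K M, F ≤ P ∧ Module.finrank K F = m := by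
  obtain ⟨F, hF, huniq⟩ := existsUnique_intermediateField_finrank hm
  refine ⟨IntermediateField.lift F, ⟨IntermediateField.lift_le F, ?_⟩, ?_⟩
  · rw [← hF]
    exact (IntermediateField.liftAlgEquiv F).toLinearEquiv.finrank_eq.symm
  · rintro F' ⟨hle, hF'⟩
    rw [← huniq (IntermediateField.restrict hle) ?_, IntermediateField.lift_restrict]
    rw [← hF']
    exact (IntermediateField.restrictAlgEquiv hle).toLinearEquiv.finrank_eq.symm

/-- Over `F`, the degree of the compositum is at most `[P : F] [E : F]`, and it equals `[E : F] [L :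
E]`; cancel `[E : F]`. -/
theorem relfinrank_le_of_le_sup {F P E L : IntermediateField K M} [FiniteDimensional K L]
    (hFP : F ≤ P) (hFE : F ≤ E) (hEL : E ≤ L) (hPL : P ≤ L) (hL : L ≤ P ⊔ E) :
    E.relfinrank L ≤ F.relfinrank P := by
  have hL' : L = P ⊔ E := le_antisymm hL (sup_le hPL hEL)
  have h1 := IntermediateField.relfinrank_mul_relfinrank hFE hEL
  have h2 := IntermediateField.finrank_bot_mul_relfinrank (hFE.trans hEL)
  have hpos : 0 < Module.finrank K L := Module.finrank_pos
  have h3 : F.relfinrank L ≤ F.relfinrank P * F.relfinrank E := by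
    subst hL'
    rw [IntermediateField.relfinrank_eq_finrank_of_le hFP,
      IntermediateField.relfinrank_eq_finrank_of_le hFE,
      IntermediateField.relfinrank_eq_finrank_of_le (hFE.trans hEL)]
    have := IntermediateField.extendScalars_sup hFP hFE
    rw [← this]
    exact IntermediateField.finrank_sup_le _ _
  rw [← h2, ← h1] at hpos
  have hE : 0 < F.relfinrank E := Nat.pos_of_mul_pos_right (Nat.pos_of_mul_pos_left hpos)
  rw [← h1, mul_comm] at h3
  exact Nat.le_of_mul_le_mul_right h3 hE

end Galois

/-! ### Cyclotomic fields: the degree of ℚ(ζ_{ph}) over F(ζ_h) -/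

section Cyclotomic

variable {k K : Type*} [Field k] [Field K] [Algebra k K]

theorem isCyclotomicExtension_adjoin_simple {ζ : K} {m : ℕ} [NeZero m] (hζ : IsPrimitiveRoot ζ m) :
    IsCyclotomicExtension {m} k k⟮ζ⟯ :=
  (IntermediateField.isCyclotomicExtension_singleton_iff_eq_adjoin m k K _ hζ).2 rfl

theorem finrank_adjoin_simple {ζ : K} {m : ℕ} [NeZero m] (hζ : IsPrimitiveRoot ζ m)
    (hirr : Irreducible (Polynomial.cyclotomic m k)) :
    Module.finrank k k⟮ζ⟯ = m.totient := by
  have := isCyclotomicExtension_adjoin_simple (k := k) hζ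
  exact IsCyclotomicExtension.finrank (n := m) _ hirr

theorem existsUnique_le_adjoin_finrank [CharZero k] {ζ : K} {p m : ℕ} (hp : p.Prime)
    (hζ : IsPrimitiveRoot ζ p) (hirr : Irreducible (Polynomial.cyclotomic p k)) (hm : m ∣ p - 1) :
    ∃! F : IntermediateField k K, F ≤ k⟮ζ⟯ ∧ Module.finrank k F = m := by
  have : Fact p.Prime := ⟨hp⟩
  have := isCyclotomicExtension_adjoin_simple (k := k) hζ
  have : FiniteDimensional k k⟮ζ⟯ := IsCyclotomicExtension.finiteDimensional {p} k _
  have : IsGalois k k⟮ζ⟯ := IsCyclotomicExtension.isGalois {p} k _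
  have h := IsCyclotomicExtension.zeta_spec p k k⟮ζ⟯
  have : IsCyclic (k⟮ζ⟯ ≃ₐ[k] k⟮ζ⟯) :=
    isCyclic_of_injective (h.autToPow k) (h.autToPow_injective k)
  refine existsUnique_le_finrank _ ?_
  rwa [finrank_adjoin_simple hζ hirr, Nat.totient_prime hp]

variable {F : IntermediateField k K} {p d h : ℕ} {ζp ζh ζ : K}

theorem adjoin_simple_le_of_pow_eq_one {m : ℕ} [NeZero m] (hζ : IsPrimitiveRoot ζ m) {x : K}
    (hx : x ^ m = 1) : k⟮x⟯ ≤ k⟮ζ⟯ := by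
  obtain ⟨i, -, rfl⟩ := hζ.eq_pow_of_pow_eq_one hx
  rw [IntermediateField.adjoin_simple_le_iff]
  exact pow_mem (IntermediateField.mem_adjoin_simple_self k ζ) i

theorem sup_adjoin_le (hp : p.Prime) (hh : 0 < h)
    (hζ : IsPrimitiveRoot ζ (p * h)) (hζp : IsPrimitiveRoot ζp p) (hζh : IsPrimitiveRoot ζh h)
    (hF : F ≤ k⟮ζp⟯) : F ⊔ k⟮ζh⟯ ≤ k⟮ζ⟯ := by
  have : NeZero (p * h) := ⟨(Nat.mul_pos hp.pos hh).ne'⟩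
  refine sup_le (hF.trans (adjoin_simple_le_of_pow_eq_one hζ ?_))
    (adjoin_simple_le_of_pow_eq_one hζ ?_)
  · rw [pow_mul, hζp.pow_eq_one, one_pow]
  · rw [mul_comm, pow_mul, hζh.pow_eq_one, one_pow]

/-- Upper bound: `ζ` is a power of `ζp * ζh`, so adjoining `ζp` gives everything, and the degree is
at most `[k(ζp) : F] = d`. Lower bound: the total degree is `(p - 1) φ(h)`, while the base has
degree at most `[F : k] φ(h)`. -/
theorem relfinrank_sup_adjoin (hirr : ∀ m, 0 < m → Irreducible (Polynomial.cyclotomic m k))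
    (hp : p.Prime) (hh : 0 < h) (hph : p.Coprime h)
    (hζ : IsPrimitiveRoot ζ (p * h)) (hζp : IsPrimitiveRoot ζp p) (hζh : IsPrimitiveRoot ζh h)
    (hF : F ≤ k⟮ζp⟯) (hd : Module.finrank k F * d = p - 1) :
    (F ⊔ k⟮ζh⟯).relfinrank k⟮ζ⟯ = d := by
  have : NeZero p := ⟨hp.ne_zero⟩
  have : NeZero h := ⟨hh.ne'⟩
  have : NeZero (p * h) := ⟨(Nat.mul_pos hp.pos hh).ne'⟩
  have := isCyclotomicExtension_adjoin_simple (k := k) hζ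
  have : FiniteDimensional k k⟮ζ⟯ := IsCyclotomicExtension.finiteDimensional {p * h} k _
  have hle := sup_adjoin_le hp hh hζ hζp hζh hF
  have hpos : 0 < p - 1 := Nat.sub_pos_of_lt hp.one_lt
  have hFpos : 0 < Module.finrank k F := Nat.pos_of_mul_pos_right (hd ▸ hpos)
  have hPL : k⟮ζp⟯ ≤ k⟮ζ⟯ := adjoin_simple_le_of_pow_eq_one hζ (by
    rw [pow_mul, hζp.pow_eq_one, one_pow])
  have hFP : F.relfinrank k⟮ζp⟯ = d := by
    have h1 := IntermediateField.finrank_bot_mul_relfinrank hF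
    rw [finrank_adjoin_simple hζp (hirr _ hp.pos), Nat.totient_prime hp, ← hd] at h1
    exact Nat.eq_of_mul_eq_mul_left hFpos h1
  refine le_antisymm ((relfinrank_le_of_le_sup hF le_sup_left hle hPL ?_).trans hFP.le) ?_
  · refine (adjoin_simple_le_of_pow_eq_one (isPrimitiveRoot_mul_of_coprime hζp hζh hph)
      hζ.pow_eq_one).trans ?_
    rw [IntermediateField.adjoin_simple_le_iff]
    exact mul_mem ((le_sup_left : _ ≤ k⟮ζp⟯ ⊔ (F ⊔ k⟮ζh⟯))
        (IntermediateField.mem_adjoin_simple_self k ζp))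
      ((le_sup_right.trans le_sup_right : k⟮ζh⟯ ≤ k⟮ζp⟯ ⊔ (F ⊔ k⟮ζh⟯))
        (IntermediateField.mem_adjoin_simple_self k ζh))
  · have h1 := IntermediateField.finrank_bot_mul_relfinrank hle
    have h2 := IntermediateField.finrank_sup_le F k⟮ζh⟯
    rw [finrank_adjoin_simple hζ (hirr _ (NeZero.pos _)), Nat.totient_mul hph, Nat.totient_prime hp, ← hd] at h1
    rw [finrank_adjoin_simple hζh (hirr _ hh)] at h2
    have h3 : Module.finrank k F * h.totient * d ≤
        Module.finrank k F * h.totient * (F ⊔ k⟮ζh⟯).relfinrank k⟮ζ⟯ := by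
      calc _ = Module.finrank k F * d * h.totient := by ring
        _ ≤ _ := by rw [← h1]; exact Nat.mul_le_mul_right _ h2
    exact Nat.le_of_mul_le_mul_left h3 (Nat.mul_pos hFpos (Nat.totient_pos.2 hh))

theorem isCyclotomicExtension_extendScalars {E : IntermediateField k K} {m : ℕ} [NeZero m]
    (hζ : IsPrimitiveRoot ζ m) (hle : E ≤ k⟮ζ⟯) :
    IsCyclotomicExtension {m} k (IntermediateField.extendScalars hle) := by
  have := isCyclotomicExtension_adjoin_simple (k := k) hζ
  exact IsCyclotomicExtension.equiv {m} k k⟮ζ⟯ (AlgEquiv.ofRingEquiv (f :=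
    { toFun := fun x => (⟨x.1, x.2⟩ : IntermediateField.extendScalars hle)
      invFun := fun x => ⟨x.1, x.2⟩
      map_mul' := fun _ _ => rfl
      map_add' := fun _ _ => rfl }) (fun r => rfl))

end Cyclotomic

/-! ### The action of Galois automorphisms on ζ_p -/

section Character

variable {E L : Type*} [Field E] [Field L] [Algebra E L]
  {k : Type*} [Field k] [Algebra k E] [Algebra k L] [IsScalarTower k E L]
  {p : ℕ} [NeZero p] {ω : L}

/-- An automorphism over `E` fixes `z`, so its value at `ω` determines its value at the generator `ω
z`. -/
theorem autToPow_injective_of_adjoin_eq_top (hω : IsPrimitiveRoot ω p) {z : E}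
    (hL : Algebra.adjoin k {ω * algebraMap E L z} = ⊤) :
    Function.Injective (hω.autToPow E) := by
  intro σ τ h
  have hω' : σ ω = τ ω := by
    rw [← hω.autToPow_spec E σ, ← hω.autToPow_spec E τ, h]
  have : (σ : L →ₐ[E] L).restrictScalars k = (τ : L →ₐ[E] L).restrictScalars k := by
    refine AlgHom.ext_of_adjoin_eq_top hL ?_
    rintro _ rfl
    change σ (ω * _) = τ (ω * _)
    rw [map_mul, map_mul, hω', AlgEquiv.commutes, AlgEquiv.commutes]
  ext x
  exact DFunLike.congr_fun this x

end Character

/-! ### Conjugation exponents and the choice of the generator b -/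

theorem zpowers_pow_eq_of_coprime {G : Type*} [Group G] {x : G} {j : ℕ}
    (h : j.Coprime (orderOf x)) : Subgroup.zpowers (x ^ j) = Subgroup.zpowers x := by
  refine le_antisymm (Subgroup.zpowers_le.2 (Subgroup.npow_mem_zpowers x j)) ?_
  obtain ⟨m, hm⟩ := exists_pow_eq_self_of_coprime h
  exact Subgroup.zpowers_le.2 (Subgroup.mem_zpowers_iff.2 ⟨m, by rw [zpow_natCast, hm]⟩)

/-- The automorphism of `⟨a⟩` induced by conjugation by `b`. -/
theorem exists_unit_conj {G : Type*} [Group G] [Finite G] {p n k : ℕ} [hp : Fact p.Prime]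
    {a b : G} (ha : orderOf a = p) (hb : orderOf b = n) (hnormal : (Subgroup.zpowers a).Normal)
    (hk : Nat.card (Subgroup.zpowers b ⊓ Subgroup.centralizer {a} : Subgroup G) = k) :
    ∃ r : (ZMod p)ˣ, b * a * b⁻¹ = a ^ (r : ZMod p).val ∧ n = orderOf r * k ∧
      Commute a (b ^ orderOf r) := by
  obtain ⟨t, ht⟩ := exists_pow_of_mem_zpowers
    (hnormal.conj_mem a (Subgroup.mem_zpowers a) b)
  have hconj : ∀ j : ℕ, b ^ j * a * (b ^ j)⁻¹ = a ^ t ^ j := fun j => by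
    simpa using pow_mul_pow_mul_inv ht.symm 1 j
  have hiff : ∀ j : ℕ, Commute a (b ^ j) ↔ (t : ZMod p) ^ j = 1 := by
    intro j
    have h1 : Commute a (b ^ j) ↔ a ^ t ^ j = a ^ 1 := by
      rw [← hconj, pow_one, mul_inv_eq_iff_eq_mul]
      exact eq_comm
    rw [h1, pow_eq_pow_iff_modEq, ha, ← ZMod.natCast_eq_natCast_iff, Nat.cast_pow, Nat.cast_one]
  have hn : (t : ZMod p) ^ n = 1 := by
    rw [← hiff, ← hb, pow_orderOf_eq_one]
    exact Commute.one_right a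
  have hn0 : n ≠ 0 := hb ▸ (orderOf_pos b).ne'
  obtain ⟨r, hr⟩ : ∃ r : (ZMod p)ˣ, (r : ZMod p) = t := ⟨Units.ofPowEqOne _ n hn hn0, rfl⟩
  have hrj : ∀ j : ℕ, Commute a (b ^ j) ↔ orderOf r ∣ j := fun j => by
    rw [hiff, ← hr, orderOf_dvd_iff_pow_eq_one, Units.ext_iff, Units.val_pow_eq_pow_val,
      Units.val_one]
  refine ⟨r, ?_, ?_, (hrj _).2 dvd_rfl⟩
  · rw [hr, ZMod.val_natCast, ← ha, pow_mod_orderOf, ht]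
  · have hdvd : orderOf r ∣ orderOf b := by
      rw [← hrj, pow_orderOf_eq_one]
      exact Commute.one_right a
    -- `b ^ j` centralizes `a` exactly when `r ^ j = 1`; comparing orders gives `n = orderOf r * k`.
    have hS : Subgroup.zpowers b ⊓ Subgroup.centralizer {a} = Subgroup.zpowers (b ^ orderOf r) := by
      ext x
      rw [Subgroup.mem_inf, Subgroup.mem_centralizer_singleton_iff]
      constructor
      · rintro ⟨hx, hc⟩
        obtain ⟨j, rfl⟩ := exists_pow_of_mem_zpowers hx
        obtain ⟨i, rfl⟩ := (hrj j).1 hc.symm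
        rw [pow_mul]
        exact Subgroup.npow_mem_zpowers _ i
      · intro hx
        obtain ⟨i, rfl⟩ := exists_pow_of_mem_zpowers hx
        rw [← pow_mul]
        have h1 := (hrj (orderOf r * i)).2 (dvd_mul_right _ _)
        exact ⟨Subgroup.npow_mem_zpowers _ _, h1.symm⟩
    rw [← hk, hS, Nat.card_zpowers, orderOf_pow_of_dvd (orderOf_pos r).ne' hdvd,
      Nat.mul_div_cancel' hdvd, hb]

/-- Two elements of the same order of a finite cyclic group are powers of one another, with
exponents that can be chosen prime to a given multiple of the order. -/
theorem IsCyclic.exists_coprime_pow_eq {Γ : Type*} [Group Γ] [Finite Γ] [IsCyclic Γ] {r s : Γ}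
    {n : ℕ} (hn : 0 < n) (h : orderOf s = orderOf r) (hdvd : orderOf r ∣ n) :
    ∃ j : ℕ, j.Coprime n ∧ r ^ j = s := by
  obtain ⟨i, rfl⟩ := exists_pow_of_mem_zpowers (IsCyclic.mem_zpowers_of_orderOf_eq h)
  have hi : i.Coprime (orderOf r) := by
    rw [orderOf_pow] at h
    have h1 := Nat.div_mul_cancel (Nat.gcd_dvd_left (orderOf r) i)
    rw [h] at h1
    exact Nat.Coprime.symm (Nat.eq_of_mul_eq_mul_left (orderOf_pos r) (h1.trans (mul_one _).symm))
  have : NeZero n := ⟨hn.ne'⟩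
  -- Units modulo `orderOf r` lift to units modulo `n`, so the exponent can be made prime to `n`.
  obtain ⟨u, hu⟩ := ZMod.unitsMap_surjective hdvd (ZMod.unitOfCoprime i hi)
  refine ⟨(u : ZMod n).val, ZMod.val_coe_unit_coprime u, ?_⟩
  rw [pow_eq_pow_iff_modEq, ← ZMod.natCast_eq_natCast_iff]
  have h2 := congrArg Units.val hu
  rw [ZMod.unitsMap_val, ZMod.coe_unitOfCoprime] at h2
  rw [← h2, ZMod.natCast_val]

namespace IsSplitMetacyclic

variable {G : Type*} [Group G] [Finite G] {a b : G} {p d k : ℕ}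

omit [Finite G] in
-- Another generator of `⟨b⟩` acts on `a` with another exponent. This is the freedom needed to match
-- an arbitrary generator of the Galois group.
theorem pow (hG : IsSplitMetacyclic a b p d k) {j : ℕ} (hj : j.Coprime (d * k)) :
    IsSplitMetacyclic a (b ^ j) p d k where
  one_lt := hG.one_lt
  orderOf_left := hG.orderOf_left
  orderOf_right := by rw [← hG.orderOf_right] at hj ⊢; exact hj.symm.orderOf_pow
  coprime := hG.coprime
  normal := hG.normal
  compl := by
    rw [zpowers_pow_eq_of_coprime (hG.orderOf_right ▸ hj)]
    exact hG.compl
  commute := by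
    rw [← pow_mul, mul_comm, pow_mul]
    exact hG.commute.pow_right j

omit [Finite G] in
theorem zpowers_pow_pow (hG : IsSplitMetacyclic a b p d k) {j : ℕ} (hj : j.Coprime (d * k))
    (m : ℕ) : Subgroup.zpowers ((b ^ j) ^ m) = Subgroup.zpowers (b ^ m) := by
  rw [← pow_mul, mul_comm, pow_mul]
  refine zpowers_pow_eq_of_coprime (hj.coprime_dvd_right ?_)
  rw [← hG.orderOf_right]
  exact orderOf_pow_dvd m

theorem zpowers_mul_pow_pow (hG : IsSplitMetacyclic a b p d k) {j : ℕ} (hj : j.Coprime (d * k)) :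
    Subgroup.zpowers (a * (b ^ j) ^ d) = Subgroup.zpowers (a * b ^ d) := by
  have hz := hG.zpowers_pow_pow hj d
  rw [hG.zpowers_mul_pow, (hG.pow hj).zpowers_mul_pow]
  have key : ∀ x y : G, Subgroup.zpowers x = Subgroup.zpowers y →
      Subgroup.closure {a, x} ≤ Subgroup.closure {a, y} := by
    intro x y hxy
    rw [Subgroup.closure_le]
    rintro _ (rfl | rfl)
    · exact Subgroup.subset_closure (by simp)
    · have h1 : Subgroup.zpowers y ≤ Subgroup.closure {a, y} :=
        Subgroup.zpowers_le.2 (Subgroup.subset_closure (by simp))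
      exact h1 (hxy ▸ Subgroup.mem_zpowers _)
  exact le_antisymm (key _ _ hz) (key _ _ hz.symm)

theorem eElt_eq (hG : IsSplitMetacyclic a b p d k) {h : ℕ} (hk : h ∣ k) :
    eElt (Subgroup.closure {a, b ^ d}) (Subgroup.zpowers (b ^ (h * d))) =
      epsElt (Subgroup.zpowers (a * b ^ d)) (Subgroup.zpowers (b ^ (h * d))) := by
  rw [← hG.zpowers_mul_pow]
  exact eElt_eq_epsElt (hG.commute_epsElt hk)

/-- The representation of `G` in the cyclic algebra `(L/E, z)`, for an arbitrary generator of the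
Galois group and an arbitrary primitive `h`-th root of unity `z`. -/
theorem exists_algHom_of_orderOf_eq [hp : Fact p.Prime] (hG : IsSplitMetacyclic a b p d k)
    {r : (ZMod p)ˣ} (hr : b * a * b⁻¹ = a ^ (r : ZMod p).val) (hrd : orderOf r = d) {h : ℕ}
    (hk : h ∣ k) {E L : Type*} [Field E] [Field L] [Algebra E L] [FiniteDimensional E L]
    [Algebra ℚ E] [Algebra ℚ L] [IsScalarTower ℚ E L]
    (σ : L ≃ₐ[E] L) (hσ : ∀ g, g ∈ Subgroup.zpowers σ) (z : Eˣ)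
    {ω : L} (hω : IsPrimitiveRoot ω p)
    (hz : IsPrimitiveRoot (algebraMap E L z) h) (hd : orderOf σ = d)
    (hL : Algebra.adjoin ℚ {ω * algebraMap E L z} = ⊤) :
    ∃ ψ : MonoidAlgebra ℚ G →ₐ[ℚ] CyclicAlgebra σ hσ z, Function.Surjective ψ ∧
      ψ (epsElt (Subgroup.zpowers (a * b ^ d)) (Subgroup.zpowers (b ^ (h * d)))) = 1 ∧
      ∀ x, ψ x = 0 →
        x * epsElt (Subgroup.zpowers (a * b ^ d)) (Subgroup.zpowers (b ^ (h * d))) = 0 := by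
  have hs : orderOf (hω.autToPow E σ) = orderOf r := by
    rw [orderOf_injective _ (autToPow_injective_of_adjoin_eq_top hω hL), hd, hrd]
  -- The exponent of `σ` on `ω` and `r` both have order `d` in the cyclic group `(ZMod p)ˣ`, so some
  -- `b ^ j` with `j` prime to `n` conjugates `a` as `σ` moves `ω`.
  obtain ⟨j, hj, hrj⟩ := IsCyclic.exists_coprime_pow_eq (n := d * k) hG.pos hs
    (hrd ▸ dvd_mul_right d k)
  have hconj : b ^ j * a * (b ^ j)⁻¹ = a ^ (hω.autToPow E σ : ZMod p).val := by
    have h1 := pow_mul_pow_mul_inv hr 1 j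
    rw [pow_one, one_mul] at h1
    rw [h1, pow_eq_pow_iff_modEq, hG.orderOf_left, ← ZMod.natCast_eq_natCast_iff, Nat.cast_pow,
      ZMod.natCast_zmod_val, ZMod.natCast_zmod_val, ← hrj, Units.val_pow_eq_pow_val]
  have := (hG.pow hj).exists_algHom σ hσ z hk hconj hω hz (hω.autToPow_spec E σ).symm hd hL
  rwa [hG.zpowers_mul_pow_pow hj, hG.zpowers_pow_pow hj] at this

/-- The cyclic extension `ℚ(ζ_{ph}) / F(ζ_h)` and the representations of `G` in the cyclic algebras
`(ℚ(ζ_{ph}) / F(ζ_h), ζ_h)`. -/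
theorem exists_cyclicAlgebra [hp : Fact p.Prime] (hG : IsSplitMetacyclic a b p d k)
    {r : (ZMod p)ˣ} (hr : b * a * b⁻¹ = a ^ (r : ZMod p).val) (hrd : orderOf r = d)
    {ζ : ℕ → ℂ} (hζ : ∀ m, 0 < m → IsPrimitiveRoot (ζ m) m)
    {F : IntermediateField ℚ ℂ} (hF : F ≤ ℚ⟮ζ p⟯) (hFd : Module.finrank ℚ F * d = p - 1)
    {h : ℕ} (hk : h ∣ k) :
    ∃ hle : F ⊔ ℚ⟮ζ h⟯ ≤ ℚ⟮ζ (p * h)⟯,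
    ∃ _ : FiniteDimensional ↥(F ⊔ ℚ⟮ζ h⟯) ↥(IntermediateField.extendScalars hle),
    ∃ z : (↥(F ⊔ ℚ⟮ζ h⟯))ˣ, ((z : ↥(F ⊔ ℚ⟮ζ h⟯)) : ℂ) = ζ h ∧
      IsGalois ↥(F ⊔ ℚ⟮ζ h⟯) ↥(IntermediateField.extendScalars hle) ∧
      IsCyclic (↥(IntermediateField.extendScalars hle) ≃ₐ[↥(F ⊔ ℚ⟮ζ h⟯)]
        ↥(IntermediateField.extendScalars hle)) ∧
      ∀ (σ : ↥(IntermediateField.extendScalars hle) ≃ₐ[↥(F ⊔ ℚ⟮ζ h⟯)]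
          ↥(IntermediateField.extendScalars hle)) (hσ : ∀ g, g ∈ Subgroup.zpowers σ),
        orderOf σ = d ∧
        ∃ ψ : MonoidAlgebra ℚ G →ₐ[ℚ] CyclicAlgebra σ hσ z, Function.Surjective ψ ∧
          ψ (epsElt (Subgroup.zpowers (a * b ^ d)) (Subgroup.zpowers (b ^ (h * d)))) = 1 ∧
          ∀ x, ψ x = 0 →
            x * epsElt (Subgroup.zpowers (a * b ^ d)) (Subgroup.zpowers (b ^ (h * d))) = 0 := by
  have hh : 0 < h := Nat.pos_of_dvd_of_pos hk hG.pos_right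
  have hph0 : 0 < p * h := Nat.mul_pos hp.out.pos hh
  have : NeZero (p * h) := ⟨hph0.ne'⟩
  have hph : p.Coprime h := hG.coprime_right.coprime_dvd_right hk
  have hle := sup_adjoin_le hp.out hh (hζ _ hph0) (hζ p hp.out.pos) (hζ h hh) hF
  have hrel := relfinrank_sup_adjoin
    (fun m hm => Polynomial.cyclotomic.irreducible_rat hm) hp.out hh hph
    (hζ _ hph0) (hζ p hp.out.pos) (hζ h hh) hF hFd
  rw [IntermediateField.relfinrank_eq_finrank_of_le hle] at hrel
  have hcyc : IsCyclotomicExtension {p * h} ℚ (IntermediateField.extendScalars hle) := by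
    exact isCyclotomicExtension_extendScalars (k := ℚ) (hζ _ hph0) hle
  have hfin : FiniteDimensional ℚ (IntermediateField.extendScalars hle) :=
    IsCyclotomicExtension.finiteDimensional {p * h} ℚ _
  have hgal : IsGalois ℚ (IntermediateField.extendScalars hle) :=
    IsCyclotomicExtension.isGalois {p * h} ℚ _
  have hfd : FiniteDimensional ↥(F ⊔ ℚ⟮ζ h⟯) ↥(IntermediateField.extendScalars hle) :=
    Module.Finite.right ℚ _ _
  have hgal' : IsGalois ↥(F ⊔ ℚ⟮ζ h⟯) ↥(IntermediateField.extendScalars hle) :=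
    IsGalois.tower_top_of_isGalois ℚ _ _
  have hmem : ζ h ∈ F ⊔ ℚ⟮ζ h⟯ :=
    (le_sup_right : ℚ⟮ζ h⟯ ≤ _) (IntermediateField.mem_adjoin_simple_self ℚ (ζ h))
  have hmem' : ζ p ∈ IntermediateField.extendScalars hle := by
    rw [IntermediateField.mem_extendScalars]
    refine adjoin_simple_le_of_pow_eq_one (hζ _ hph0) ?_
      (IntermediateField.mem_adjoin_simple_self ℚ (ζ p))
    rw [pow_mul, (hζ p hp.out.pos).pow_eq_one, one_pow]
  let z : (↥(F ⊔ ℚ⟮ζ h⟯))ˣ := Units.mk0 ⟨ζ h, hmem⟩ fun h0 =>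
    (hζ h hh).ne_zero hh.ne' (congrArg Subtype.val h0)
  let ω : ↥(IntermediateField.extendScalars hle) := ⟨ζ p, hmem'⟩
  have hω : IsPrimitiveRoot ω p :=
    IsPrimitiveRoot.of_map_of_injective
      (f := algebraMap ↥(IntermediateField.extendScalars hle) ℂ) (hζ p hp.out.pos)
      (algebraMap ↥(IntermediateField.extendScalars hle) ℂ).injective
  have hz : IsPrimitiveRoot
      (algebraMap ↥(F ⊔ ℚ⟮ζ h⟯) ↥(IntermediateField.extendScalars hle) z) h :=
    IsPrimitiveRoot.of_map_of_injective
      (f := algebraMap ↥(IntermediateField.extendScalars hle) ℂ) (hζ h hh)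
      (algebraMap ↥(IntermediateField.extendScalars hle) ℂ).injective
  have hL := IsCyclotomicExtension.adjoin_primitive_root_eq_top (A := ℚ)
    (isPrimitiveRoot_mul_of_coprime hω hz hph)
  refine ⟨hle, hfd, z, rfl, hgal', ?_, fun σ hσ => ?_⟩
  · exact isCyclic_of_injective _ (autToPow_injective_of_adjoin_eq_top hω hL)
  · have hd : orderOf σ = d := by
      rw [orderOf_eq_card_of_forall_mem_zpowers hσ, IsGalois.card_aut_eq_finrank, hrel]
    exact ⟨hd, hG.exists_algHom_of_orderOf_eq hr hrd hk σ hσ z hω hz hd hL⟩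

end IsSplitMetacyclic

/-! ### The main theorem -/

theorem lemma3p1
    {G : Type*} [Group G] [Finite G] (p n k : ℕ) (hp : p.Prime) (hpn : ¬ p ∣ n)
    -- `G = ⟨a⟩_p ⋊_k ⟨b⟩_n`
    (a b : G) (ha : orderOf a = p) (hb : orderOf b = n)
    (hnormal : (Subgroup.zpowers a).Normal)
    (hcompl : Subgroup.IsComplement' (Subgroup.zpowers a) (Subgroup.zpowers b))
    (hk : Nat.card (Subgroup.zpowers b ⊓ Subgroup.centralizer {a} : Subgroup G) = k)
    -- `ζ m` is a complex primitive `m`-th root of unity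
    (ζ : ℕ → ℂ) (hζ : ∀ m, 0 < m → IsPrimitiveRoot (ζ m) m) :
    (∃! F : IntermediateField ℚ ℂ, F ≤ ℚ⟮ζ p⟯ ∧ Module.finrank ℚ F = (p - 1) * k / n) ∧
    (k ≠ n → ∀ B : NonUnitalSubalgebra ℚ (MonoidAlgebra ℚ G),
      (IsSimpleComponent B ∧ ∃ x ∈ B, ∃ y ∈ B, x * y ≠ y * x) ↔
        ∃ h, h ∣ k ∧ B = compB a b n k h) ∧
    ∀ F : IntermediateField ℚ ℂ, F ≤ ℚ⟮ζ p⟯ → Module.finrank ℚ F = (p - 1) * k / n →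
      ∀ h, h ∣ k →
        -- with `E = F(ζ_h)` and `L = ℚ(ζ_{ph})`, the extension `L/E` is finite cyclic
        ∃ hle : F ⊔ ℚ⟮ζ h⟯ ≤ ℚ⟮ζ (p * h)⟯,
        ∃ _ : FiniteDimensional ↥(F ⊔ ℚ⟮ζ h⟯) ↥(IntermediateField.extendScalars hle),
        ∃ z : (↥(F ⊔ ℚ⟮ζ h⟯))ˣ, ((z : ↥(F ⊔ ℚ⟮ζ h⟯)) : ℂ) = ζ h ∧
          IsGalois ↥(F ⊔ ℚ⟮ζ h⟯) ↥(IntermediateField.extendScalars hle) ∧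
          IsCyclic (↥(IntermediateField.extendScalars hle) ≃ₐ[↥(F ⊔ ℚ⟮ζ h⟯)]
            ↥(IntermediateField.extendScalars hle)) ∧
          -- and `B_h ≅ (L/E, ζ_h)`, whatever generator of `Gal(L/E)` is used
          ∀ (σ : ↥(IntermediateField.extendScalars hle) ≃ₐ[↥(F ⊔ ℚ⟮ζ h⟯)]
              ↥(IntermediateField.extendScalars hle))
            (hσ : ∀ g, g ∈ Subgroup.zpowers σ),
            ∃ φ : compB a b n k h ≃ₗ[ℚ] CyclicAlgebra σ hσ z,
              ∀ x y, φ (x * y) = φ x * φ y := by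
  have hpf : Fact p.Prime := ⟨hp⟩
  have hn0 : 0 < n := hb ▸ orderOf_pos b
  obtain ⟨r, hr, hn, hcomm⟩ := exists_unit_conj ha hb hnormal hk
  obtain ⟨d, hrd⟩ : ∃ d, orderOf r = d := ⟨_, rfl⟩
  rw [hrd] at hn hcomm
  have hk0 : 0 < k := Nat.pos_of_mul_pos_left (hn ▸ hn0)
  have hd0 : 0 < d := Nat.pos_of_mul_pos_right (hn ▸ hn0)
  have hG : IsSplitMetacyclic a b p d k :=
    { one_lt := hp.one_lt
      orderOf_left := ha
      orderOf_right := hb.trans hn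
      coprime := hn ▸ hp.coprime_iff_not_dvd.2 hpn
      normal := hnormal
      compl := hcompl
      commute := hcomm }
  have hnk : n / k = d := by rw [hn, Nat.mul_div_cancel _ hk0]
  obtain ⟨m, hm⟩ : d ∣ p - 1 := by
    rw [← hrd, ← ZMod.card_units p, ← Nat.card_eq_fintype_card]
    exact orderOf_dvd_natCard r
  have hdeg : (p - 1) * k / n = m := by
    rw [hm, hn, mul_right_comm, Nat.mul_div_cancel_left _ (Nat.mul_pos hd0 hk0)]
  have hF : ∃! F : IntermediateField ℚ ℂ, F ≤ ℚ⟮ζ p⟯ ∧ Module.finrank ℚ F = (p - 1) * k / n := by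
    rw [hdeg]
    exact existsUnique_le_adjoin_finrank hp (hζ p hp.pos)
      (Polynomial.cyclotomic.irreducible_rat hp.pos) (hm ▸ dvd_mul_left m d)
  have hrep := fun (F : IntermediateField ℚ ℂ) (hFle : F ≤ ℚ⟮ζ p⟯)
      (hFd : Module.finrank ℚ F = (p - 1) * k / n) (h : ℕ) (hh : h ∣ k) =>
    hG.exists_cyclicAlgebra hr hrd hζ hFle (by rw [hFd, hdeg, hm, mul_comm]) hh
  have hcompB : ∀ h, h ∣ k → compB a b n k h =
      componentOf (epsElt (Subgroup.zpowers (a * b ^ d)) (Subgroup.zpowers (b ^ (h * d)))) := by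
    intro h hh
    rw [compB, hnk, hG.eElt_eq hh]
  refine ⟨hF, fun hkn B => ?_, fun F hFle hFd h hh => ?_⟩
  · obtain ⟨F, ⟨hFle, hFd⟩, -⟩ := hF
    have hd1 : d ≠ 1 := by
      rintro rfl
      exact hkn (by rw [hn, one_mul])
    have hatom : ∀ h (hh : h ∣ k), IsAtom (centralIdeal (hG.commute_epsElt hh)) := by
      intro h hh
      obtain ⟨hle, hfd, z, -, -, hcyc, hψ⟩ := hrep F hFle hFd h hh
      obtain ⟨σ, hσ⟩ := hcyc.exists_generator
      obtain ⟨-, ψ, hsurj, hone, hker⟩ := hψ σ hσ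
      have := CyclicAlgebra.nontrivial σ hσ z
      exact isAtom_centralIdeal _ ψ hsurj hone hker
        fun I f hf hf0 => CrossedProduct.one_mem_of_ne_zero I hf hf0
    constructor
    · rintro ⟨⟨I, hI, hBI⟩, x, hx, y, hy, hxy⟩
      have hmem : ∀ x, x ∈ B ↔ x ∈ I := fun x => Set.ext_iff.1 hBI x
      rw [hmem] at hx hy
      by_contra! hne
      have hzero : ∀ x ∈ I, ∀ h, h ∣ k →
          x * epsElt (Subgroup.zpowers (a * b ^ d)) (Subgroup.zpowers (b ^ (h * d))) = 0 := by
        intro x hx h hh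
        by_contra h0
        have hat := hatom h hh
        -- Distinct minimal ideals meet in zero, but `x ε_h` lies in both.
        have hIe : I = centralIdeal (hG.commute_epsElt hh) := by
          by_contra hIne
          have hbot := (hI.disjoint_of_ne hat hIne).eq_bot
          refine h0 ?_
          rw [← TwoSidedIdeal.mem_bot, ← hbot, TwoSidedIdeal.mem_inf]
          exact ⟨I.mul_mem_right _ _ hx, (mem_centralIdeal _).2 ⟨x, rfl⟩⟩
        refine hne h hh (SetLike.coe_injective ?_)
        rw [hBI, hIe, hcompB h hh, coe_componentOf_eq (hG.commute_epsElt hh)]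
      -- Both elements lie in the commutative ideal cut out by the idempotent of `⟨a⟩`, against
      -- their choice.
      have hx' := hG.eq_mul_hatElt hp (hzero x hx)
      have hy' := hG.eq_mul_hatElt hp (hzero y hy)
      have hxy' := hG.mul_mul_hatElt_comm x y
      rw [mul_assoc, mul_assoc, ← hx', ← hy'] at hxy'
      exact hxy hxy'
    · rintro ⟨h, hh, rfl⟩
      rw [hcompB h hh]
      refine ⟨⟨_, hatom h hh, coe_componentOf_eq (hG.commute_epsElt hh)⟩, ?_⟩
      obtain ⟨hle, hfd, z, -, -, hcyc, hψ⟩ := hrep F hFle hFd h hh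
      obtain ⟨σ, hσ⟩ := hcyc.exists_generator
      obtain ⟨hσd, ψ, hsurj, hone, hker⟩ := hψ σ hσ
      obtain ⟨f, g, hfg⟩ := CyclicAlgebra.exists_mul_ne_mul σ hσ z (hσd ▸ hd1)
      obtain ⟨φ, hφ⟩ := exists_componentOf_linearEquiv ψ hsurj hone hker
      refine ⟨φ.symm f, (φ.symm f).2, φ.symm g, (φ.symm g).2, fun heq => hfg ?_⟩
      have := congrArg φ (Subtype.ext heq : φ.symm f * φ.symm g = φ.symm g * φ.symm f)
      simpa only [hφ, LinearEquiv.apply_symm_apply] using this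
  · obtain ⟨hle, hfd, z, hz, hgal, hcyc, hψ⟩ := hrep F hFle hFd h hh
    refine ⟨hle, hfd, z, hz, hgal, hcyc, fun σ hσ => ?_⟩
    obtain ⟨-, ψ, hsurj, hone, hker⟩ := hψ σ hσ
    rw [hcompB h hh]
    exact exists_componentOf_linearEquiv ψ hsurj hone hker
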